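/- Let $p\ge 2$ be an integer and $\mathcal S^{p-1}$ the unit sphere of $\mathbb R^p$. Let $f:\mathbb R\to[0,\infty)$ be monotone increasing, twice differentiable at $0$, with $f(0)=f'(0)=1$. For $\theta\in\mathcal S^{p-1}$ and $\kappa\ge 0$, consider the distribution on $\mathcal S^{p-1}$ with density, with respect to the surface area measure, $$x\mapsto \frac{c_{p,\kappa,f}\,\Gamma(\frac{p-1}2)}{2\pi^{(p-1)/2}}\,f(\kappa(x'\theta)^2),\qquad c_{p,\kappa,f}=1\Big/\int_{-1}^1(1-s^2)^{(p-3)/2}f(\kappa s^2)\,ds .$$ Reparametrize by $\vartheta=\sqrt\kappa\,\theta\in\mathbb R^p$. For $\vartheta\ne 0$, let ${\rm P}^{(n)}_{\vartheta,f}$ be the joint law of $n$ independent observations $X_{n1},\dots,X_{nn}$ from this distribution with $\theta=\vartheta/\|\vartheta\|$ and $\kappa=\|\vartheta\|^2$. Let ${\rm P}^{(n)}_0={\rm P}^{(n)}_{0,f}$ be the joint law of $n$ independent observations uniformly distributed on $\mathcal S^{p-1}$. Let $\vartheta_n=(p/\sqrt n)^{1/2}\tau_n$, where $(\tau_n)$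 is a sequence in $\mathbb R^p$ that is $O(1)$ but not $o(1)$. Put $S_n=\frac1n\sum_{i=1}^nX_{ni}X_{ni}'$, $$\Delta^{(n)}=p\sqrt n\,\mathrm{vec}\Big(S_n-\frac1pI_p\Big),\qquad \Gamma_p=\frac p{p+2}\Big(I_{p^2}+K_p-\frac2pJ_p\Big),$$ where $\mathrm{vec}$ stacks the columns of a matrix, $J_p=(\mathrm{vec}\,I_p)(\mathrm{vec}\,I_p)'$, and $K_p=\sum_{i,j=1}^p(e_ie_j')\otimes(e_je_i')$ is the commutation matrix, with $e_1,\dots,e_p$ the canonical basis of $\mathbb R^p$. Then, as $n\to\infty$ under ${\rm P}^{(n)}_0$, $$\log\frac{d{\rm P}^{(n)}_{\vartheta_n,f}}{d{\rm P}^{(n)}_0}=(\mathrm{vec}(\tau_n\tau_n'))'\Delta^{(n)}-\frac12(\mathrm{vec}(\tau_n\tau_n'))'\,\Gamma_p\,\mathrm{vec}(\tau_n\tau_n')+o_{\rm P}(1),$$ and $\Delta^{(n)}$ is, still under ${\rm P}^{(n)}_0$, asymptotically normal with mean vector zero and covariance matrix $\Gamma_p$. -/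

import Mathlib

open MeasureTheory ProbabilityTheory Filter Topology Asymptotics Matrix
open scoped Kronecker

noncomputable section

/-- The unit sphere `𝒮^{p-1}` of `ℝ^p`. -/
abbrev UnitSphere (p : ℕ) : Type :=
  Metric.sphere (0 : EuclideanSpace ℝ (Fin p)) 1

/-- The (non-normalized) surface area measure on `𝒮^{p-1}`. -/
def surfaceMeasure (p : ℕ) : Measure (UnitSphere p) :=
  (volume : Measure (EuclideanSpace ℝ (Fin p))).toSphere

/-- The uniform distribution on `𝒮^{p-1}`. -/
def uniformSphere (p : ℕ) : Measure (UnitSphere p) :=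
  (surfaceMeasure p Set.univ)⁻¹ • surfaceMeasure p

instance isFiniteMeasure_surfaceMeasure (p : ℕ) : IsFiniteMeasure (surfaceMeasure p) := by
  unfold surfaceMeasure; infer_instance

instance isProbabilityMeasure_uniformSphere (p : ℕ) [hp : Fact (2 ≤ p)] :
    IsProbabilityMeasure (uniformSphere p) := by
  have : Nontrivial (EuclideanSpace ℝ (Fin p)) := by
    have : NeZero p := ⟨by have := hp.out; omega⟩
    infer_instance
  have h0 : surfaceMeasure p ≠ 0 := Measure.toSphere_ne_zero _
  have : NeZero (surfaceMeasure p) := ⟨h0⟩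
  unfold uniformSphere
  infer_instance

/-- The class `ℱ` of functions `f : ℝ → [0, ∞)` that are monotone increasing, twice differentiable
at `0` (that is, differentiable near `0` with a derivative differentiable at `0`), and such that
`f 0 = f' 0 = 1`. -/
structure IsAngularFunction (f : ℝ → ℝ) : Prop where
  nonneg : ∀ x, 0 ≤ f x
  monotone : Monotone f
  differentiableAt_near : ∀ᶠ x in 𝓝 (0 : ℝ), DifferentiableAt ℝ f x
  differentiableAt_deriv : DifferentiableAt ℝ (deriv f) 0
  map_zero : f 0 = 1
  deriv_zero : deriv f 0 = 1

/-- The normalizing constant `c_{p,κ,f}`. -/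
def axialConst (p : ℕ) (κ : ℝ) (f : ℝ → ℝ) : ℝ :=
  1 / ∫ s in (-1 : ℝ)..1, (1 - s ^ 2) ^ (((p : ℝ) - 3) / 2) * f (κ * s ^ 2)

/-- The axial density with location `θ`, concentration `κ` and angular function `f`, with respect
to the surface area measure on the sphere. -/
def axialDensity {p : ℕ} (θ : EuclideanSpace ℝ (Fin p)) (κ : ℝ) (f : ℝ → ℝ)
    (x : UnitSphere p) : ℝ :=
  axialConst p κ f * Real.Gamma (((p : ℝ) - 1) / 2) / (2 * Real.pi ^ (((p : ℝ) - 1) / 2)) *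
    f (κ * (inner ℝ (x : EuclideanSpace ℝ (Fin p)) θ) ^ 2)

/-- The axial distribution with location `θ`, concentration `κ` and angular function `f`. -/
def axialLaw {p : ℕ} (θ : EuclideanSpace ℝ (Fin p)) (κ : ℝ) (f : ℝ → ℝ) :
    Measure (UnitSphere p) :=
  (surfaceMeasure p).withDensity fun x => ENNReal.ofReal (axialDensity θ κ f x)

open Classical in
/-- The axial distribution in the parametrization `ϑ = √κ θ`, `κ ≥ 0`: location `ϑ / ‖ϑ‖` and
concentration `‖ϑ‖ ^ 2` if `ϑ ≠ 0`, the uniform distribution if `ϑ = 0`. -/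
def flatLaw {p : ℕ} (ϑ : EuclideanSpace ℝ (Fin p)) (f : ℝ → ℝ) : Measure (UnitSphere p) :=
  if ϑ = 0 then uniformSphere p else axialLaw (‖ϑ‖⁻¹ • ϑ) (‖ϑ‖ ^ 2) f

/-- The null hypothesis: the joint law of `n` independent uniform observations on the sphere. -/
abbrev nullLaw (p n : ℕ) : Measure (Fin n → UnitSphere p) :=
  Measure.pi fun _ => uniformSphere p

/-- The alternative: the joint law of `n` independent observations from `flatLaw ϑ f`. -/
def altLaw {p : ℕ} (n : ℕ) (ϑ : EuclideanSpace ℝ (Fin p)) (f : ℝ → ℝ) :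
    Measure (Fin n → UnitSphere p) :=
  Measure.pi fun _ => flatLaw ϑ f

/-- The sample covariance matrix `S_n = n⁻¹ ∑ X_i X_i'` (with respect to the origin). -/
def sampleCov {p n : ℕ} (x : Fin n → UnitSphere p) : Matrix (Fin p) (Fin p) ℝ :=
  (n : ℝ)⁻¹ • ∑ i, vecMulVec (x i : EuclideanSpace ℝ (Fin p)).ofLp
    (x i : EuclideanSpace ℝ (Fin p)).ofLp

/-- The central sequence `Δ = p √n vec (S_n - I_p / p)`. -/
def centralSeq {p n : ℕ} (x : Fin n → UnitSphere p) : EuclideanSpace ℝ (Fin p × Fin p) :=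
  WithLp.toLp 2 (((p : ℝ) * √(n : ℝ)) •
    vec (sampleCov x - (1 / (p : ℝ)) • (1 : Matrix (Fin p) (Fin p) ℝ)))

/-- The commutation matrix `K_p = ∑ (e_i e_j') ⊗ (e_j e_i')`. -/
def commutationMatrix (p : ℕ) : Matrix (Fin p × Fin p) (Fin p × Fin p) ℝ :=
  ∑ i : Fin p, ∑ j : Fin p, Matrix.single i j (1 : ℝ) ⊗ₖ Matrix.single j i (1 : ℝ)

/-- The matrix `J_p = (vec I_p) (vec I_p)'`. -/
def jMatrix (p : ℕ) : Matrix (Fin p × Fin p) (Fin p × Fin p) ℝ :=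
  vecMulVec (vec (1 : Matrix (Fin p) (Fin p) ℝ)) (vec (1 : Matrix (Fin p) (Fin p) ℝ))

/-- The information matrix `Γ_p = (p / (p + 2)) (I + K_p - (2 / p) J_p)`. -/
def infoMatrix (p : ℕ) : Matrix (Fin p × Fin p) (Fin p × Fin p) ℝ :=
  ((p : ℝ) / ((p : ℝ) + 2)) • (1 + commutationMatrix p - (2 / (p : ℝ)) • jMatrix p)

/-- The vector `vec (t t')`. -/
def vecOuter {p : ℕ} (t : EuclideanSpace ℝ (Fin p)) : Fin p × Fin p → ℝ :=
  vec (vecMulVec t.ofLp t.ofLp)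

end

/-! Write `k = ‖ϑ‖ ^ 2`, `a = f''(0)` and `m = 3 / (p (p + 2))`. Relative to the uniform law, one
observation has density `f ((x'ϑ)²) / uniformMean f ϑ` (`flatLaw_eq_withDensity`), so the
log-likelihood ratio is `∑ log f ((X_i'ϑ)²) - n log (uniformMean f ϑ)`. Since `(x'ϑ)² ≤ k → 0`, both
logarithms can be expanded to second order, uniformly in `x`, with error `o(k²)` per observation.
These errors are negligible in total because `n k² = p² ‖τ‖⁴` is bounded.

The first-order terms, `∑ (X_i'ϑ)² - n k / p`, equal the linear term in `Δ` exactly. In the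
second-order terms, Chebyshev's inequality allows `(X_i'ϑ)⁴` to be replaced by its mean `m k²`. What
remains is `n k² ((a - 1) m / 2 - a m / 2 + 1 / (2 p²)) = -(1/2) (p² m - 1) ‖τ‖⁴`. The curvature `a`
cancels, so the limit is free of `f`, and `(p² m - 1) ‖τ‖⁴` is the quadratic form of `Γ_p` at `vec
(ττ')` (`vecOuter_dotProduct_infoMatrix`).

Asymptotic normality is the central limit theorem for the bounded centered vectors `p vec (x x' - I
/ p)`, whose covariance `Γ_p` comes from the fourth moments of the uniform law. The marginal formula
`lintegral_surfaceMeasure_inner` serves twice: it identifies the normalizing constant, and it shows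
that projections have the same law in all directions, whence the moments. -/

open scoped ENNReal

/-! ### Surface integrals of functions of one projection -/

/-- Polar coordinates in a normed space. -/
lemma lintegral_eq_lintegral_toSphere_prod {E : Type*} [NormedAddCommGroup E] [NormedSpace ℝ E]
    [MeasurableSpace E] [BorelSpace E] [FiniteDimensional ℝ E] [Nontrivial E] (μ : Measure E)
    [μ.IsAddHaarMeasure] {F : E → ℝ≥0∞} (hF : Measurable F) :
    ∫⁻ z, F z ∂μ = ∫⁻ x : Metric.sphere (0 : E) 1, (∫⁻ r in Set.Ioi (0 : ℝ),
      ENNReal.ofReal (r ^ (Module.finrank ℝ E - 1)) * F (r • (x : E))) ∂μ.toSphere := by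
  have hmp := (μ.measurePreserving_homeomorphUnitSphereProd).symm
    (homeomorphUnitSphereProd E).toMeasurableEquiv
  calc ∫⁻ z, F z ∂μ = ∫⁻ z : ({(0)}ᶜ : Set E), F z ∂(μ.comap (↑)) := by
        rw [lintegral_subtype_comap (measurableSet_singleton _).compl, restrict_compl_singleton]
    _ = ∫⁻ q, F ((homeomorphUnitSphereProd E).symm q : E)
          ∂(μ.toSphere.prod (.volumeIoiPow (Module.finrank ℝ E - 1))) := by
        rw [← hmp.lintegral_comp (f := fun z : ({(0)}ᶜ : Set E) => F z)
          (hF.comp measurable_subtype_coe)]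
        rfl
    _ = ∫⁻ q : Metric.sphere (0 : E) 1 × Set.Ioi (0 : ℝ), F ((q.2 : ℝ) • (q.1 : E))
          ∂(μ.toSphere.prod (.volumeIoiPow (Module.finrank ℝ E - 1))) := by
        rfl
    _ = _ := by
        rw [lintegral_prod _ (by fun_prop)]
        refine lintegral_congr fun x => ?_
        rw [Measure.volumeIoiPow, lintegral_withDensity_eq_lintegral_mul _ (by fun_prop) (by fun_prop),
          ← lintegral_subtype_comap measurableSet_Ioi]
        rfl

/-- Cartesian decomposition of an integrand depending on one coordinate and the norm. -/
lemma lintegral_inner_norm_eq {m : ℕ} {θ : EuclideanSpace ℝ (Fin (m + 1))} (hθ : ‖θ‖ = 1)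
    {Φ : ℝ × ℝ → ℝ≥0∞} (hΦ : Measurable Φ) :
    ∫⁻ z : EuclideanSpace ℝ (Fin (m + 1)), Φ (inner ℝ z θ, ‖z‖) =
      ∫⁻ t : ℝ, ∫⁻ y : EuclideanSpace ℝ (Fin m), Φ (t, √(t ^ 2 + ‖y‖ ^ 2)) := by
  -- The one-element family `θ` is completed to an orthonormal basis with `θ` in position `0`, so
  -- that the projection on `θ` becomes the first coordinate.
  have horth : Orthonormal ℝ (({0} : Set (Fin (m + 1))).domRestrict fun _ => θ) := by
    constructor
    · intro i; exact hθ
    · intro i j hij; exact absurd (Subsingleton.elim i j) hij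
  obtain ⟨b, hb⟩ := horth.exists_orthonormalBasis_extension_of_card_eq (by simp)
  have hb0 : b 0 = θ := hb 0 rfl
  have e1 : ∀ z, Φ (inner ℝ z θ, ‖z‖) = Φ (b.repr z 0, ‖b.repr z‖) := by
    intro z
    rw [b.repr_apply_apply, hb0, real_inner_comm, LinearIsometryEquiv.norm_map]
  simp_rw [e1]
  rw [b.measurePreserving_repr.lintegral_comp
    (f := fun w : EuclideanSpace ℝ (Fin (m + 1)) => Φ (w 0, ‖w‖)) (by fun_prop),
    ← (PiLp.volume_preserving_toLp (Fin (m + 1))).lintegral_comp (by fun_prop),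
    ← ((volume_preserving_piFinSuccAbove (fun _ : Fin (m + 1) => ℝ) 0).symm _).lintegral_comp
      (by fun_prop), Measure.volume_eq_prod, lintegral_prod _ (by fun_prop)]
  refine lintegral_congr fun t => ?_
  rw [← (PiLp.volume_preserving_toLp (Fin m)).lintegral_comp
    (f := fun y : EuclideanSpace ℝ (Fin m) => Φ (t, √(t ^ 2 + ‖y‖ ^ 2))) (by fun_prop)]
  refine lintegral_congr fun y => ?_
  simp [EuclideanSpace.norm_eq, Fin.sum_univ_succ, MeasurableEquiv.piFinSuccAbove,
    Real.sq_sqrt (Finset.sum_nonneg fun (i : Fin m) _ => sq_nonneg (y i))]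

/-- Polar coordinates in the upper half-plane. -/
lemma lintegral_upperHalfPlane_polar {F : ℝ × ℝ → ℝ≥0∞} (hF : Measurable F) :
    ∫⁻ t : ℝ, ∫⁻ ρ in Set.Ioi (0 : ℝ), F (t, ρ) =
      ∫⁻ r in Set.Ioi (0 : ℝ), ∫⁻ φ in Set.Ioo 0 Real.pi,
        ENNReal.ofReal r * F (r * Real.cos φ, r * Real.sin φ) := by
  have h := lintegral_comp_polarCoord_symm
    ((Set.univ ×ˢ Set.Ioi (0 : ℝ)).indicator F)
  have hm : MeasurableSet ((Set.univ : Set ℝ) ×ˢ Set.Ioi (0 : ℝ)) :=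
    MeasurableSet.univ.prod measurableSet_Ioi
  rw [lintegral_indicator hm, Measure.volume_eq_prod, ← Measure.prod_restrict, Measure.restrict_univ,
    lintegral_prod _ hF.aemeasurable] at h
  rw [← h, polarCoord_target, ← Measure.prod_restrict, lintegral_prod]
  swap
  · refine Measurable.aemeasurable ?_
    have := hF.indicator hm
    simp only [polarCoord_symm_apply, smul_eq_mul]
    fun_prop
  refine setLIntegral_congr_fun measurableSet_Ioi fun r hr => ?_
  have hr : 0 < r := hr
  have hsub : Set.Ioo 0 Real.pi ⊆ Set.Ioo (-Real.pi) Real.pi :=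
    Set.Ioo_subset_Ioo_left (by linarith [Real.pi_pos])
  rw [← Set.inter_eq_self_of_subset_left hsub, ← setLIntegral_indicator measurableSet_Ioo]
  refine setLIntegral_congr_fun measurableSet_Ioo fun φ hφ => ?_
  simp only [polarCoord_symm_apply, smul_eq_mul, Set.indicator_apply, Set.mem_prod, Set.mem_univ,
    true_and, Set.mem_Ioi]
  by_cases h0 : 0 < φ
  · have hs := Real.sin_pos_of_pos_of_lt_pi h0 hφ.2
    rw [if_pos (mul_pos hr hs), if_pos (show φ ∈ Set.Ioo 0 Real.pi from ⟨h0, hφ.2⟩)]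
  · have hs := Real.sin_nonpos_of_nonpos_of_neg_pi_le (not_lt.mp h0) hφ.1.le
    rw [if_neg (not_lt.mpr (mul_nonpos_of_nonneg_of_nonpos hr.le hs)), if_neg (fun h => h0 h.1),
      mul_zero]

/-- The substitution `s = cos φ`. -/
lemma lintegral_cos_substitution (m : ℕ) (hm : 1 ≤ m) (G : ℝ → ℝ≥0∞) :
    ∫⁻ φ in Set.Ioo 0 Real.pi, ENNReal.ofReal (Real.sin φ ^ (m - 1)) * G (Real.cos φ) =
      ∫⁻ s in Set.Ioo (-1 : ℝ) 1, ENNReal.ofReal ((1 - s ^ 2) ^ (((m : ℝ) - 2) / 2)) * G s := by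
  have himg : Real.cos '' Set.Ioo 0 Real.pi = Set.Ioo (-1 : ℝ) 1 := by
    ext s
    constructor
    · rintro ⟨φ, hφ, rfl⟩
      constructor
      · have := Real.strictAntiOn_cos ⟨hφ.1.le, hφ.2.le⟩ ⟨Real.pi_pos.le, le_rfl⟩ hφ.2
        rwa [Real.cos_pi] at this
      · have := Real.strictAntiOn_cos ⟨le_rfl, Real.pi_pos.le⟩ ⟨hφ.1.le, hφ.2.le⟩ hφ.1
        rwa [Real.cos_zero] at this
    · intro hs
      refine ⟨Real.arccos s, ⟨Real.arccos_pos.2 hs.2, ?_⟩, Real.cos_arccos hs.1.le hs.2.le⟩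
      refine lt_of_le_of_ne (Real.arccos_le_pi s) fun h => ?_
      rw [Real.arccos_eq_pi] at h
      linarith [hs.1]
  rw [← himg, lintegral_image_eq_lintegral_abs_deriv_mul measurableSet_Ioo
    (fun φ _ => (Real.hasDerivAt_cos φ).hasDerivWithinAt)
    (Real.injOn_cos.mono Set.Ioo_subset_Icc_self)]
  refine setLIntegral_congr_fun measurableSet_Ioo fun φ hφ => ?_
  have hs := Real.sin_pos_of_pos_of_lt_pi hφ.1 hφ.2
  rw [← mul_assoc, ← ENNReal.ofReal_mul (abs_nonneg _)]
  congr 2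
  -- The Jacobian takes one power of `sin φ`, leaving `(sin φ) ^ (m - 2)`. This exponent is `-1`
  -- when `m = 1`, hence the real power.
  rw [abs_neg, abs_of_pos hs, ← Real.sin_sq, ← Real.rpow_natCast, ← Real.rpow_natCast,
    ← Real.rpow_mul hs.le]
  conv_rhs => rw [← Real.rpow_one (Real.sin φ), ← Real.rpow_mul hs.le, ← Real.rpow_add hs]
  congr 1
  push_cast [hm]
  ring

lemma toSphere_univ_euclideanSpace {m : ℕ} (hm : 1 ≤ m) :
    (volume : Measure (EuclideanSpace ℝ (Fin m))).toSphere Set.univ =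
      ENNReal.ofReal (2 * Real.pi ^ ((m : ℝ) / 2) / Real.Gamma ((m : ℝ) / 2)) := by
  have : Nonempty (Fin m) := ⟨⟨0, hm⟩⟩
  have hm0 : (0 : ℝ) < (m : ℝ) / 2 := by positivity
  rw [Measure.toSphere_apply_univ, EuclideanSpace.volume_ball, finrank_euclideanSpace,
    Fintype.card_fin, ENNReal.ofReal_one, one_pow, one_mul, ← ENNReal.ofReal_natCast,
    ← ENNReal.ofReal_mul (by positivity)]
  congr 1
  rw [Real.Gamma_add_one hm0.ne', Real.sqrt_eq_rpow, ← Real.rpow_natCast, ← Real.rpow_mul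
    Real.pi_pos.le]
  have hG := (Real.Gamma_pos_of_pos hm0).ne'
  have hm' : (m : ℝ) ≠ 0 := by positivity
  rw [show (1 : ℝ) / 2 * m = m / 2 by ring]
  field_simp

/-- Under the surface measure, the projection on an axis has density proportional to
`(1 - s ^ 2) ^ ((p - 3) / 2)`. -/
lemma lintegral_surfaceMeasure_inner {p : ℕ} (hp : 2 ≤ p) {θ : EuclideanSpace ℝ (Fin p)}
    (hθ : ‖θ‖ = 1) {G : ℝ → ℝ≥0∞} (hG : Measurable G) :
    ∫⁻ x, G (inner ℝ (x : EuclideanSpace ℝ (Fin p)) θ) ∂surfaceMeasure p =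
      ENNReal.ofReal (2 * Real.pi ^ (((p : ℝ) - 1) / 2) / Real.Gamma (((p : ℝ) - 1) / 2)) *
        ∫⁻ s in Set.Ioo (-1 : ℝ) 1, ENNReal.ofReal ((1 - s ^ 2) ^ (((p : ℝ) - 3) / 2)) * G s := by
  obtain ⟨m, rfl⟩ : ∃ m, p = m + 1 := ⟨p - 1, by omega⟩
  have hm : 1 ≤ m := by omega
  have : Nonempty (Fin m) := ⟨⟨0, hm⟩⟩
  -- A radial cutoff: integrating `H ‖z‖ * G (⟨z, θ⟩ / ‖z‖)` over the whole space in two ways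
  -- produces the same radial factor `C`, which is finite and nonzero and therefore cancels.
  set H : ℝ → ℝ≥0∞ := (Set.Ioo (0 : ℝ) 1).indicator 1 with hH
  have hHm : Measurable H := measurable_one.indicator measurableSet_Ioo
  set C : ℝ≥0∞ := ∫⁻ r in Set.Ioi (0 : ℝ), ENNReal.ofReal (r ^ m) * H r with hC
  have hC' : C = ∫⁻ r in Set.Ioo (0 : ℝ) 1, ENNReal.ofReal (r ^ m) := by
    rw [hC, ← Set.inter_eq_self_of_subset_left (Set.Ioo_subset_Ioi_self (a := (1 : ℝ)) (b := 0)),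
      ← setLIntegral_indicator measurableSet_Ioo]
    refine lintegral_congr fun r => ?_
    by_cases hr : r ∈ Set.Ioo (0 : ℝ) 1 <;> simp [hH, hr]
  have hC0 : C ≠ 0 := by
    rw [hC']
    refine ne_of_gt ((setLIntegral_pos_iff (by fun_prop)).2 ?_)
    have hs : Set.Ioo (0 : ℝ) 1 ⊆
        Function.support (fun r : ℝ => ENNReal.ofReal (r ^ m)) ∩ Set.Ioo (0 : ℝ) 1 := by
      intro r hr
      exact ⟨by simpa using pow_pos hr.1 m, hr⟩
    exact lt_of_lt_of_le (by simp) (measure_mono hs)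
  have hCtop : C ≠ ∞ := by
    rw [hC']
    refine ne_of_lt (lt_of_le_of_lt (setLIntegral_mono (g := fun _ => 1) measurable_const
      fun r hr => ?_) (by simp))
    exact ENNReal.ofReal_le_one.2 (pow_le_one₀ hr.1.le hr.2.le)
  set Φ : ℝ × ℝ → ℝ≥0∞ := fun q => H q.2 * G (q.1 / q.2) with hΦ
  have hΦm : Measurable Φ := by fun_prop
  have key := lintegral_inner_norm_eq hθ hΦm
  have lhs : ∫⁻ z : EuclideanSpace ℝ (Fin (m + 1)), Φ (inner ℝ z θ, ‖z‖) =
      C * ∫⁻ x, G (inner ℝ (x : EuclideanSpace ℝ (Fin (m + 1))) θ) ∂surfaceMeasure (m + 1) := by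
    rw [lintegral_eq_lintegral_toSphere_prod _ (by fun_prop), surfaceMeasure, hC,
      ← lintegral_const_mul _ (by fun_prop)]
    refine lintegral_congr fun x => ?_
    rw [← lintegral_mul_const _ (by fun_prop)]
    refine setLIntegral_congr_fun measurableSet_Ioi fun r hr => ?_
    have hr : 0 < r := hr
    have hx : ‖(x : EuclideanSpace ℝ (Fin (m + 1)))‖ = 1 := by simp
    simp only [hΦ, norm_smul, hx, real_inner_smul_left, Real.norm_eq_abs, abs_of_pos hr, mul_one,
      finrank_euclideanSpace, Fintype.card_fin, Nat.add_sub_cancel, mul_div_cancel_left₀ _ hr.ne',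
      mul_assoc]
  -- Polar coordinates are used twice: in the orthogonal complement of `θ`, with radius `ρ`, then
  -- for `(t, ρ)` in the upper half-plane. The factors `r` and `r ^ (m - 1)` recombine into the `r ^
  -- m` of `C`.
  have rhs : ∫⁻ t : ℝ, ∫⁻ y : EuclideanSpace ℝ (Fin m), Φ (t, √(t ^ 2 + ‖y‖ ^ 2)) =
      (volume : Measure (EuclideanSpace ℝ (Fin m))).toSphere Set.univ *
        (C * ∫⁻ φ in Set.Ioo 0 Real.pi,
          ENNReal.ofReal (Real.sin φ ^ (m - 1)) * G (Real.cos φ)) := by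
    have h1 : ∀ t : ℝ, ∫⁻ y : EuclideanSpace ℝ (Fin m), Φ (t, √(t ^ 2 + ‖y‖ ^ 2)) =
        (volume : Measure (EuclideanSpace ℝ (Fin m))).toSphere Set.univ *
          ∫⁻ ρ in Set.Ioi (0 : ℝ), ENNReal.ofReal (ρ ^ (m - 1)) * Φ (t, √(t ^ 2 + ρ ^ 2)) := by
      intro t
      rw [lintegral_eq_lintegral_toSphere_prod _ (by fun_prop), mul_comm, ← lintegral_const]
      refine lintegral_congr fun x => ?_
      refine setLIntegral_congr_fun measurableSet_Ioi fun r hr => ?_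
      have hr : 0 < r := hr
      have hx : ‖(x : EuclideanSpace ℝ (Fin m))‖ = 1 := by simp
      simp only [norm_smul, hx, Real.norm_eq_abs, abs_of_pos hr, mul_one, finrank_euclideanSpace,
        Fintype.card_fin]
    simp_rw [h1]
    rw [lintegral_const_mul' _ _ (measure_ne_top _ _),
      lintegral_upperHalfPlane_polar
        (F := fun q => ENNReal.ofReal (q.2 ^ (m - 1)) * Φ (q.1, √(q.1 ^ 2 + q.2 ^ 2)))
        (by fun_prop), hC, ← lintegral_mul_const _ (by fun_prop)]
    congr 1
    refine setLIntegral_congr_fun measurableSet_Ioi fun r hr => ?_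
    have hr : 0 < r := hr
    simp only
    rw [← lintegral_const_mul _ (by fun_prop)]
    refine setLIntegral_congr_fun measurableSet_Ioo fun φ hφ => ?_
    have hs := Real.sin_pos_of_pos_of_lt_pi hφ.1 hφ.2
    have hsq : √((r * Real.cos φ) ^ 2 + (r * Real.sin φ) ^ 2) = r := by
      rw [show (r * Real.cos φ) ^ 2 + (r * Real.sin φ) ^ 2 =
        r ^ 2 * (Real.sin φ ^ 2 + Real.cos φ ^ 2) by ring, Real.sin_sq_add_cos_sq, mul_one,
        Real.sqrt_sq hr.le]
    have hrm : r ^ m = r * r ^ (m - 1) := by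
      rw [← pow_succ', Nat.sub_add_cancel hm]
    simp only [hΦ, hsq, mul_div_cancel_left₀ _ hr.ne']
    rw [mul_pow, hrm, ENNReal.ofReal_mul (by positivity), ENNReal.ofReal_mul (by positivity)]
    ring
  rw [lhs, rhs, lintegral_cos_substitution m hm, toSphere_univ_euclideanSpace hm,
    mul_left_comm, ENNReal.mul_right_inj hC0 hCtop] at key
  rw [key]
  push_cast
  rw [add_sub_cancel_right, show (m : ℝ) + 1 - 3 = m - 2 by ring]

/-! ### Moments of the uniform distribution up to order four -/

lemma Continuous.integrable_uniformSphere {p : ℕ} [Fact (2 ≤ p)] {g : UnitSphere p → ℝ}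
    (hg : Continuous g) : Integrable g (uniformSphere p) :=
  hg.integrable_of_hasCompactSupport (HasCompactSupport.of_compactSpace g)

/-- The law of a projection of a uniform vector does not depend on the direction. -/
lemma map_inner_uniformSphere {p : ℕ} [hp : Fact (2 ≤ p)] {θ θ' : EuclideanSpace ℝ (Fin p)}
    (hθ : ‖θ‖ = 1) (hθ' : ‖θ'‖ = 1) :
    (uniformSphere p).map (fun x : UnitSphere p => inner ℝ (x : EuclideanSpace ℝ (Fin p)) θ) =
      (uniformSphere p).map (fun x : UnitSphere p => inner ℝ (x : EuclideanSpace ℝ (Fin p)) θ') := by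
  refine Measure.ext_of_lintegral _ fun G hG => ?_
  rw [lintegral_map hG (by fun_prop), lintegral_map hG (by fun_prop), uniformSphere,
    lintegral_smul_measure, lintegral_smul_measure, lintegral_surfaceMeasure_inner hp.out hθ hG,
    lintegral_surfaceMeasure_inner hp.out hθ' hG]

/-- Invariance of the projection law under a change of direction, plus homogeneity in `v`. The
constant is left unknown here; the constraint `‖x‖ = 1` determines it later without evaluating any
Beta integral. -/
lemma exists_integral_inner_pow_four (p : ℕ) [hp : Fact (2 ≤ p)] :
    ∃ c : ℝ, ∀ v : EuclideanSpace ℝ (Fin p),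
      ∫ x, (inner ℝ (x : EuclideanSpace ℝ (Fin p)) v) ^ 4 ∂uniformSphere p = c * ‖v‖ ^ 4 := by
  have : NeZero p := ⟨by have := hp.out; omega⟩
  set e : EuclideanSpace ℝ (Fin p) := EuclideanSpace.single 0 1
  have he : ‖e‖ = 1 := by simp [e]
  refine ⟨∫ x, (inner ℝ (x : EuclideanSpace ℝ (Fin p)) e) ^ 4 ∂uniformSphere p, fun v => ?_⟩
  by_cases hv : v = 0
  · simp [hv]
  have hv' : ‖v‖ ≠ 0 := norm_ne_zero_iff.2 hv
  have hu : ‖‖v‖⁻¹ • v‖ = 1 := by rw [norm_smul, norm_inv, norm_norm, inv_mul_cancel₀ hv']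
  have h := congrArg (fun μ => ∫ s, s ^ 4 ∂μ) (map_inner_uniformSphere he hu)
  rw [integral_map (by fun_prop) (by fun_prop), integral_map (by fun_prop) (by fun_prop)] at h
  rw [h, ← integral_mul_const]
  refine integral_congr_ae (ae_of_all _ fun x => ?_)
  simp only [inner_smul_right]
  field_simp

/-- Polarization: `12 a² b² = (a + b)⁴ + (a - b)⁴ - 2 a⁴ - 2 b⁴`. -/
lemma integral_inner_sq_mul_inner_sq_aux {p : ℕ} [hp : Fact (2 ≤ p)] {c : ℝ}
    (hc : ∀ v : EuclideanSpace ℝ (Fin p),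
      ∫ x, (inner ℝ (x : EuclideanSpace ℝ (Fin p)) v) ^ 4 ∂uniformSphere p = c * ‖v‖ ^ 4)
    (v w : EuclideanSpace ℝ (Fin p)) :
    ∫ x, (inner ℝ (x : EuclideanSpace ℝ (Fin p)) v) ^ 2 *
      (inner ℝ (x : EuclideanSpace ℝ (Fin p)) w) ^ 2 ∂uniformSphere p =
      c / 3 * (‖v‖ ^ 2 * ‖w‖ ^ 2 + 2 * (inner ℝ v w) ^ 2) := by
  have i4 : ∀ u : EuclideanSpace ℝ (Fin p),
      Integrable (fun x : UnitSphere p => (inner ℝ (x : EuclideanSpace ℝ (Fin p)) u) ^ 4)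
        (uniformSphere p) := fun u => Continuous.integrable_uniformSphere (by fun_prop)
  have e : ∀ x : UnitSphere p, (inner ℝ (x : EuclideanSpace ℝ (Fin p)) v) ^ 2 *
      (inner ℝ (x : EuclideanSpace ℝ (Fin p)) w) ^ 2 =
      (1 / 12) * (((inner ℝ (x : EuclideanSpace ℝ (Fin p)) (v + w)) ^ 4 +
        (inner ℝ (x : EuclideanSpace ℝ (Fin p)) (v - w)) ^ 4) -
        (2 * (inner ℝ (x : EuclideanSpace ℝ (Fin p)) v) ^ 4 +
          2 * (inner ℝ (x : EuclideanSpace ℝ (Fin p)) w) ^ 4)) := by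
    intro x
    rw [inner_add_right, inner_sub_right]
    ring
  have iA := fun u w => (i4 u).add (i4 w)
  have iB := fun u w => ((i4 u).const_mul 2).add ((i4 w).const_mul 2)
  simp only [Pi.add_def] at iA iB
  simp_rw [e]
  rw [integral_const_mul, integral_sub (iA _ _) (iB _ _), integral_add (i4 _) (i4 _),
    integral_add ((i4 _).const_mul _) ((i4 _).const_mul _), integral_const_mul,
    integral_const_mul, hc, hc, hc, hc]
  have h1 := norm_add_sq_real v w
  have h2 := norm_sub_sq_real v w
  rw [show ‖v + w‖ ^ 4 = (‖v + w‖ ^ 2) ^ 2 by ring, show ‖v - w‖ ^ 4 = (‖v - w‖ ^ 2) ^ 2 by ring,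
    h1, h2]
  ring

lemma sum_inner_single_sq {p : ℕ} (v : EuclideanSpace ℝ (Fin p)) :
    ∑ i, (inner ℝ v (EuclideanSpace.single i (1 : ℝ))) ^ 2 = ‖v‖ ^ 2 := by
  simp [EuclideanSpace.real_norm_sq_eq, EuclideanSpace.inner_single_right]

lemma integral_inner_sq_mul_inner_sq {p : ℕ} [hp : Fact (2 ≤ p)]
    (v w : EuclideanSpace ℝ (Fin p)) :
    ∫ x, (inner ℝ (x : EuclideanSpace ℝ (Fin p)) v) ^ 2 *
      (inner ℝ (x : EuclideanSpace ℝ (Fin p)) w) ^ 2 ∂uniformSphere p =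
      (‖v‖ ^ 2 * ‖w‖ ^ 2 + 2 * (inner ℝ v w) ^ 2) / ((p : ℝ) * (p + 2)) := by
  obtain ⟨c, hc⟩ := exists_integral_inner_pow_four p
  have hp0 : (0 : ℝ) < p := by have := hp.out; positivity
  have h := integral_inner_sq_mul_inner_sq_aux hc
  have hone : ∑ i : Fin p, ∑ j : Fin p,
      ∫ x, (inner ℝ (x : EuclideanSpace ℝ (Fin p)) (EuclideanSpace.single i (1 : ℝ))) ^ 2 *
        (inner ℝ (x : EuclideanSpace ℝ (Fin p)) (EuclideanSpace.single j (1 : ℝ))) ^ 2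
        ∂uniformSphere p = 1 := by
    -- Summing the mixed moments over all pairs of basis vectors gives the mean of `‖x‖ ^ 4 = 1`,
    -- while the formula with `c` gives `c / 3 * (p² + 2 p)`.
    have hi : ∀ i : Fin p, ∑ j : Fin p,
        ∫ x, (inner ℝ (x : EuclideanSpace ℝ (Fin p)) (EuclideanSpace.single i (1 : ℝ))) ^ 2 *
          (inner ℝ (x : EuclideanSpace ℝ (Fin p)) (EuclideanSpace.single j (1 : ℝ))) ^ 2
          ∂uniformSphere p =
        ∫ x, (inner ℝ (x : EuclideanSpace ℝ (Fin p)) (EuclideanSpace.single i (1 : ℝ))) ^ 2 *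
          ‖(x : EuclideanSpace ℝ (Fin p))‖ ^ 2 ∂uniformSphere p := by
      intro i
      rw [← integral_finsetSum Finset.univ fun (j : Fin p) _ =>
        Continuous.integrable_uniformSphere (by fun_prop)]
      simp_rw [← Finset.mul_sum, sum_inner_single_sq]
    simp_rw [hi]
    rw [← integral_finsetSum Finset.univ fun (j : Fin p) _ =>
      Continuous.integrable_uniformSphere (by fun_prop)]
    simp_rw [← Finset.sum_mul, sum_inner_single_sq]
    simp
  have hcp : c / 3 * (p * (p + 2)) = 1 := by
    rw [← hone]
    simp_rw [h, ← Finset.mul_sum, Finset.sum_add_distrib, ← Finset.mul_sum, sum_inner_single_sq]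
    simp
    ring_nf
    tauto
  rw [h, eq_div_iff (by positivity)]
  linear_combination (‖v‖ ^ 2 * ‖w‖ ^ 2 + 2 * (inner ℝ v w) ^ 2) * hcp

/-- Inserting the factor `‖x‖ ^ 2 = 1`, written as a sum of squared coordinates, reduces the second
moment to the mixed fourth moments. -/
lemma integral_inner_sq {p : ℕ} [hp : Fact (2 ≤ p)] (v : EuclideanSpace ℝ (Fin p)) :
    ∫ x, (inner ℝ (x : EuclideanSpace ℝ (Fin p)) v) ^ 2 ∂uniformSphere p = ‖v‖ ^ 2 / p := by
  have hp0 : (0 : ℝ) < p := by have := hp.out; positivity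
  have e : ∀ x : UnitSphere p, (inner ℝ (x : EuclideanSpace ℝ (Fin p)) v) ^ 2 =
      ∑ j, (inner ℝ (x : EuclideanSpace ℝ (Fin p)) v) ^ 2 *
        (inner ℝ (x : EuclideanSpace ℝ (Fin p)) (EuclideanSpace.single j (1 : ℝ))) ^ 2 := by
    intro x
    rw [← Finset.mul_sum, sum_inner_single_sq]
    simp
  rw [integral_congr_ae (ae_of_all _ e)]
  rw [integral_finsetSum Finset.univ fun (j : Fin p) _ =>
      Continuous.integrable_uniformSphere (by fun_prop)]
  simp_rw [integral_inner_sq_mul_inner_sq, ← Finset.sum_div, Finset.sum_add_distrib,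
    ← Finset.mul_sum, sum_inner_single_sq]
  simp
  field_simp

lemma integral_inner_pow_four {p : ℕ} [hp : Fact (2 ≤ p)] (v : EuclideanSpace ℝ (Fin p)) :
    ∫ x, (inner ℝ (x : EuclideanSpace ℝ (Fin p)) v) ^ 4 ∂uniformSphere p =
      3 / ((p : ℝ) * (p + 2)) * ‖v‖ ^ 4 := by
  have h := integral_inner_sq_mul_inner_sq v v
  simp_rw [← pow_add] at h
  rw [h, real_inner_self_eq_norm_sq]
  ring

lemma integral_inner_mul_inner {p : ℕ} [hp : Fact (2 ≤ p)] (v w : EuclideanSpace ℝ (Fin p)) :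
    ∫ x, inner ℝ (x : EuclideanSpace ℝ (Fin p)) v *
      inner ℝ (x : EuclideanSpace ℝ (Fin p)) w ∂uniformSphere p = inner ℝ v w / p := by
  have i2 : ∀ u : EuclideanSpace ℝ (Fin p),
      Integrable (fun x : UnitSphere p => (inner ℝ (x : EuclideanSpace ℝ (Fin p)) u) ^ 2)
        (uniformSphere p) := fun u => Continuous.integrable_uniformSphere (by fun_prop)
  have e : ∀ x : UnitSphere p, inner ℝ (x : EuclideanSpace ℝ (Fin p)) v *
      inner ℝ (x : EuclideanSpace ℝ (Fin p)) w =
      (1 / 4) * ((inner ℝ (x : EuclideanSpace ℝ (Fin p)) (v + w)) ^ 2 -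
        (inner ℝ (x : EuclideanSpace ℝ (Fin p)) (v - w)) ^ 2) := by
    intro x
    rw [inner_add_right, inner_sub_right]
    ring
  simp_rw [e]
  rw [integral_const_mul, integral_sub (i2 _) (i2 _), integral_inner_sq, integral_inner_sq,
    norm_add_sq_real, norm_sub_sq_real]
  ring

/-- Polarization in each of the pairs `(a, b)` and `(c, d)`, through `4 s t = (s + t)² - (s - t)²`.
-/
lemma integral_inner_mul_inner_mul_inner_mul_inner {p : ℕ} [hp : Fact (2 ≤ p)]
    (a b c d : EuclideanSpace ℝ (Fin p)) :
    ∫ x, inner ℝ (x : EuclideanSpace ℝ (Fin p)) a * inner ℝ (x : EuclideanSpace ℝ (Fin p)) b *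
      (inner ℝ (x : EuclideanSpace ℝ (Fin p)) c * inner ℝ (x : EuclideanSpace ℝ (Fin p)) d)
        ∂uniformSphere p =
      (inner ℝ a b * inner ℝ c d + inner ℝ a c * inner ℝ b d + inner ℝ a d * inner ℝ b c) /
        ((p : ℝ) * (p + 2)) := by
  have i4 : ∀ u v : EuclideanSpace ℝ (Fin p),
      Integrable (fun x : UnitSphere p => (inner ℝ (x : EuclideanSpace ℝ (Fin p)) u) ^ 2 *
        (inner ℝ (x : EuclideanSpace ℝ (Fin p)) v) ^ 2)
        (uniformSphere p) := fun u v => Continuous.integrable_uniformSphere (by fun_prop)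
  have e : ∀ x : UnitSphere p,
      inner ℝ (x : EuclideanSpace ℝ (Fin p)) a * inner ℝ (x : EuclideanSpace ℝ (Fin p)) b *
      (inner ℝ (x : EuclideanSpace ℝ (Fin p)) c * inner ℝ (x : EuclideanSpace ℝ (Fin p)) d) =
      (1 / 16) * (((inner ℝ (x : EuclideanSpace ℝ (Fin p)) (a + b)) ^ 2 *
          (inner ℝ (x : EuclideanSpace ℝ (Fin p)) (c + d)) ^ 2 -
        (inner ℝ (x : EuclideanSpace ℝ (Fin p)) (a + b)) ^ 2 *
          (inner ℝ (x : EuclideanSpace ℝ (Fin p)) (c - d)) ^ 2) -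
        ((inner ℝ (x : EuclideanSpace ℝ (Fin p)) (a - b)) ^ 2 *
          (inner ℝ (x : EuclideanSpace ℝ (Fin p)) (c + d)) ^ 2 -
        (inner ℝ (x : EuclideanSpace ℝ (Fin p)) (a - b)) ^ 2 *
          (inner ℝ (x : EuclideanSpace ℝ (Fin p)) (c - d)) ^ 2)) := by
    intro x
    simp only [inner_add_right, inner_sub_right]
    ring
  have iA := fun u w z => (i4 u w).sub (i4 u z)
  simp only [Pi.sub_def] at iA
  simp_rw [e]
  rw [integral_const_mul, integral_sub (iA _ _ _) (iA _ _ _),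
    integral_sub (i4 _ _) (i4 _ _), integral_sub (i4 _ _) (i4 _ _)]
  simp only [integral_inner_sq_mul_inner_sq]
  simp only [norm_add_sq_real, norm_sub_sq_real, inner_add_right,
    inner_sub_right, inner_add_left, inner_sub_left]
  ring

/-! ### Multivariate central limit theorem -/

section CentralLimit

variable {Ω : Type*} {mΩ : MeasurableSpace Ω} {U : Measure Ω}

/-- Convergence of the powers of the characteristic function of a centered variable. -/
lemma tendsto_charFun_map_inv_sqrt_pow [IsProbabilityMeasure U] {Y : Ω → ℝ} (hY : MemLp Y 2 U) (h0 : ∫ ω, Y ω ∂U = 0) :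
    Tendsto (fun n : ℕ => charFun (U.map Y) (√n)⁻¹ ^ n) atTop
      (𝓝 (Complex.exp (-(∫ ω, Y ω ^ 2 ∂U : ℝ) / 2))) := by
  set v := ∫ ω, Y ω ^ 2 ∂U with hv
  have hv0 : 0 ≤ v := integral_nonneg fun ω => sq_nonneg _
  -- The degenerate case cannot be skipped: `Γ_p` is singular, for instance in the direction `vec
  -- I`. There `Y` vanishes almost surely and all terms equal `1`. Otherwise `Y / √v` has unit
  -- variance and is evaluated at `√v`.
  rcases hv0.eq_or_lt with hv0 | hv0
  · have hY0 : Y =ᵐ[U] 0 := by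
      have := (integral_eq_zero_iff_of_nonneg (fun ω => sq_nonneg (Y ω)) hY.integrable_sq).1
        hv0.symm
      filter_upwards [this] with ω hω
      simpa using hω
    rw [Measure.map_congr hY0, ← hv0, Pi.zero_def, Measure.map_const]
    simp
  · have hs : 0 < √v := Real.sqrt_pos.2 hv0
    have h1 := tendsto_charFun_inv_sqrt_mul_pow (P := U) (X := fun ω => (√v)⁻¹ * Y ω)
      (hY.aemeasurable.const_mul _) (by rw [integral_const_mul, h0, mul_zero])
      (by
        simp only [Pi.pow_apply, mul_pow]
        rw [integral_const_mul, ← hv, inv_pow, Real.sq_sqrt hv0.le, inv_mul_cancel₀ hv0.ne'])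
      (√v)
    have e : ((√v : ℝ) : ℂ) ^ 2 = (v : ℂ) := by
      rw [← Complex.ofReal_pow, Real.sq_sqrt hv0.le]
    rw [e] at h1
    refine h1.congr fun n => ?_
    rw [charFun_map_mul_comp hY.aemeasurable]
    congr 2
    field_simp

variable {ι : Type*} [Fintype ι] {V : Ω → EuclideanSpace ℝ ι}
  {S : Matrix ι ι ℝ}

lemma integral_inner_eq_zero [IsFiniteMeasure U] (hV : MemLp V 2 U) (h0 : ∀ q, ∫ ω, V ω q ∂U = 0)
    (t : EuclideanSpace ℝ ι) : ∫ ω, inner ℝ (V ω) t ∂U = 0 := by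
  have hq : ∀ q, Integrable (fun ω => V ω q) U := fun q => by
    have := hV.integrable (by norm_num)
    exact ((EuclideanSpace.proj q : EuclideanSpace ℝ ι →L[ℝ] ℝ)).integrable_comp this
  simp only [PiLp.inner_apply, RCLike.inner_apply, conj_trivial]
  rw [integral_finsetSum _ fun q _ => (hq q).const_mul _]
  simp [integral_const_mul, h0]

lemma integral_inner_sq_eq (hV : MemLp V 2 U) (hS : ∀ q r, ∫ ω, V ω q * V ω r ∂U = S q r)
    (t : EuclideanSpace ℝ ι) :
    ∫ ω, inner ℝ (V ω) t ^ 2 ∂U = t.ofLp ⬝ᵥ S *ᵥ t.ofLp := by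
  have hq : ∀ q, MemLp (fun ω => V ω q) 2 U := fun q =>
    (EuclideanSpace.proj q : EuclideanSpace ℝ ι →L[ℝ] ℝ).comp_memLp' hV
  have e : ∀ ω, inner ℝ (V ω) t ^ 2 = ∑ q, ∑ r, t q * t r * (V ω q * V ω r) := by
    intro ω
    simp only [PiLp.inner_apply, RCLike.inner_apply, conj_trivial]
    rw [sq, Finset.sum_mul_sum]
    refine Finset.sum_congr rfl fun q _ => Finset.sum_congr rfl fun r _ => by ring
  have hi : ∀ q r, Integrable (fun ω => t q * t r * (V ω q * V ω r)) U := fun q r =>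
    ((hq q).integrable_mul (hq r)).const_mul _
  simp_rw [e]
  rw [integral_finsetSum _ fun q _ => integrable_finsetSum _ fun r _ => hi q r]
  simp_rw [integral_finsetSum _ fun r _ => hi _ r, integral_const_mul, hS]
  simp only [dotProduct, mulVec, Finset.mul_sum]
  refine Finset.sum_congr rfl fun q _ => Finset.sum_congr rfl fun r _ => by ring

/-- The quadratic form of `S` at `t` is the second moment of `⟨V, t⟩`. Positivity is what the
characteristic function formula of the Gaussian law with covariance `S` requires. -/
lemma posSemidef_of_integral_mul (hV : MemLp V 2 U)
    (hS : ∀ q r, ∫ ω, V ω q * V ω r ∂U = S q r) : S.PosSemidef := by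
  refine Matrix.PosSemidef.of_dotProduct_mulVec_nonneg ?_ fun t => ?_
  · ext q r
    simp only [conjTranspose_apply, star_trivial, ← hS]
    simp_rw [mul_comm]
  · have h := integral_inner_sq_eq hV hS (WithLp.toLp 2 t)
    simp only [star_trivial]
    rw [← h]
    exact integral_nonneg fun ω => sq_nonneg _

/-- **Multivariate central limit theorem** for independent copies of a centered square-integrable
random vector with covariance matrix `S`. -/
theorem tendstoInDistribution_inv_sqrt_smul_sum_pi [IsProbabilityMeasure U]
    [DecidableEq ι] (hVm : Measurable V) (hV : MemLp V 2 U)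
    (h0 : ∀ q, ∫ ω, V ω q ∂U = 0) (hS : ∀ q r, ∫ ω, V ω q * V ω r ∂U = S q r) :
    TendstoInDistribution (fun (n : ℕ) (x : Fin n → Ω) => (√n)⁻¹ • ∑ i, V (x i)) atTop
      (id : EuclideanSpace ℝ ι → EuclideanSpace ℝ ι)
      (fun n : ℕ => Measure.pi fun _ : Fin n => U) (multivariateGaussian 0 S) where
  forall_aemeasurable n := by
    have : Measurable fun x : Fin n → Ω => (√n)⁻¹ • ∑ i, V (x i) := by fun_prop
    exact this.aemeasurable
  tendsto := by
    refine ProbabilityMeasure.tendsto_iff_tendsto_charFun.2 fun t => ?_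
    simp only [ProbabilityMeasure.coe_mk, Measure.map_id]
    rw [charFun_multivariateGaussian (posSemidef_of_integral_mul hV hS), inner_zero_right]
    -- Reduction to dimension one: the characteristic function of `V` at `t / √n` is that of `⟨V,
    -- t⟩` at `1 / √n`.
    have hY : MemLp (fun ω => inner ℝ (V ω) t) 2 U := hV.inner_const t
    have h := tendsto_charFun_map_inv_sqrt_pow hY (integral_inner_eq_zero hV h0 t)
    rw [integral_inner_sq_eq hV hS] at h
    convert! h using 2 with n
    · have hind : iIndepFun (fun (i : Fin n) (x : Fin n → Ω) => V (x i))
          (Measure.pi fun _ : Fin n => U) := iIndepFun_pi fun _ => hVm.aemeasurable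
      have hm : (Measure.pi fun _ : Fin n => U).map (fun x => (√n)⁻¹ • ∑ i, V (x i)) =
          ((Measure.pi fun _ : Fin n => U).map (fun x => ∑ i, V (x i))).map
            (fun y => (√n)⁻¹ • y) := by
        rw [Measure.map_map (by fun_prop) (by fun_prop)]
        rfl
      have hVi : ∀ i : Fin n, AEMeasurable (fun x : Fin n → Ω => V (x i))
          (Measure.pi fun _ : Fin n => U) :=
        fun i => (hVm.comp (measurable_pi_apply i)).aemeasurable
      rw [hm, charFun_map_smul, hind.charFun_map_fun_sum_eq_prod hVi]
      have hi : ∀ i : Fin n, (Measure.pi fun _ : Fin n => U).map (fun x => V (x i)) = U.map V := by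
        intro i
        have := (measurePreserving_eval (fun _ : Fin n => U) i).map_eq
        conv_rhs => rw [← this]
        rw [Measure.map_map hVm (measurable_pi_apply i)]
        rfl
      simp only [hi, Finset.prod_const, Finset.card_univ, Fintype.card_fin, Pi.pow_apply]
      congr 1
      rw [charFun_apply, charFun_apply, integral_map (by fun_prop) (by fun_prop),
        integral_map (by fun_prop) (by fun_prop)]
      refine integral_congr_ae (ae_of_all _ fun ω => ?_)
      simp [inner_smul_right, mul_comm]
    · simp [neg_div]

end CentralLimit

/-! ### Second-order expansions at the origin -/

section Taylor

variable {g : ℝ → ℝ}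

/-- Second-order Taylor expansion with Peano remainder. -/
lemma sub_taylor_two_isLittleO (h1 : ∀ᶠ x in 𝓝 (0 : ℝ), DifferentiableAt ℝ g x)
    (h2 : DifferentiableAt ℝ (deriv g) 0) :
    (fun x => g x - g 0 - deriv g 0 * x - deriv (deriv g) 0 / 2 * x ^ 2) =o[𝓝 0]
      fun x => x ^ 2 := by
  obtain ⟨δ, hδ, hs⟩ := Metric.eventually_nhds_iff_ball.1 h1
  have h0 : (0 : ℝ) ∈ Metric.ball (0 : ℝ) δ := Metric.mem_ball_self hδ
  -- The derivative of the Taylor remainder is `o(x)` since `deriv g` is differentiable at `0`; on a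
  -- convex neighborhood this integrates to a remainder `o(x²)`.
  have hd : (fun x => deriv g x - deriv g 0 - deriv (deriv g) 0 * x) =o[𝓝[Metric.ball 0 δ] 0]
      fun x => (x - 0) ^ 1 := by
    have := h2.hasDerivAt.isLittleO
    simp only [sub_zero, smul_eq_mul] at this
    simp only [sub_zero, pow_one]
    refine (this.mono nhdsWithin_le_nhds).congr_left fun x => by simp [mul_comm]
  have h := (convex_ball (0 : ℝ) δ).isLittleO_pow_succ_real h0
    (f := fun x => g x - deriv g 0 * x - deriv (deriv g) 0 / 2 * x ^ 2)
    (fun x hx => by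
      have e1 : HasDerivAt (fun x : ℝ => deriv g 0 * x) (deriv g 0) x := by
        simpa using (hasDerivAt_id x).const_mul (deriv g 0)
      have e2 : HasDerivAt (fun x : ℝ => deriv (deriv g) 0 / 2 * x ^ 2)
          (deriv (deriv g) 0 * x) x := by
        convert! (hasDerivAt_pow 2 x).const_mul (deriv (deriv g) 0 / 2) using 1
        simp
        ring
      exact (((hs x hx).hasDerivAt.sub e1).sub e2).hasDerivWithinAt) hd
  rw [Metric.isOpen_ball.nhdsWithin_eq h0] at h
  refine h.congr (fun x => ?_) fun x => by simp
  simp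
  ring

/-- Second-order expansion of a logarithm. -/
lemma log_sub_taylor_two_isLittleO (h1 : ∀ᶠ x in 𝓝 (0 : ℝ), DifferentiableAt ℝ g x)
    (h2 : DifferentiableAt ℝ (deriv g) 0) (hg0 : g 0 = 1) (hg1 : deriv g 0 = 1) :
    (fun x => Real.log (g x) - x - (deriv (deriv g) 0 - 1) / 2 * x ^ 2) =o[𝓝 0]
      fun x => x ^ 2 := by
  have hc : ContinuousAt g 0 := h1.self_of_nhds.continuousAt
  have hne : ∀ᶠ x in 𝓝 (0 : ℝ), g x ≠ 0 := hc.eventually_ne (by simp [hg0])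
  have hderiv : deriv (fun x => Real.log (g x)) =ᶠ[𝓝 0] fun x => deriv g x / g x := by
    filter_upwards [h1, hne] with x hx hx'
    exact (hx.hasDerivAt.log hx').deriv
  -- Quotient rule at `0`: `(g'' g - g'²) / g² = g'' - 1`.
  have hquot : HasDerivAt (fun x => deriv g x / g x) (deriv (deriv g) 0 - 1) 0 := by
    have := h2.hasDerivAt.div h1.self_of_nhds.hasDerivAt (by simp [hg0])
    simpa [hg0, hg1, Pi.div_def] using this
  have hd2 := hquot.congr_of_eventuallyEq hderiv
  have h := sub_taylor_two_isLittleO (g := fun x => Real.log (g x))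
    (by filter_upwards [h1, hne] with x hx hx' using hx.log hx') hd2.differentiableAt
  rw [hd2.deriv, hderiv.self_of_nhds] at h
  simpa [hg0, hg1] using h

lemma log_one_add_sub_isLittleO :
    (fun y : ℝ => Real.log (1 + y) - y + y ^ 2 / 2) =o[𝓝 0] fun y => y ^ 2 := by
  have hd : deriv (fun y : ℝ => 1 + y) = fun _ => 1 := by
    ext y
    simp
  have h := log_sub_taylor_two_isLittleO (g := fun y : ℝ => 1 + y)
    (Eventually.of_forall fun x => by fun_prop) (by rw [hd]; fun_prop) (by simp) (by simp)
  rw [hd] at h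
  refine h.congr_left fun y => ?_
  simp
  ring

end Taylor

/-! ### Product measures: densities, likelihood ratios, Chebyshev's inequality -/

section Product

variable {Ω : Type*} {mΩ : MeasurableSpace Ω} {U : Measure Ω} [IsProbabilityMeasure U]
  {ι : Type*} [Fintype ι]

/-- On a box, the indicator times the product density is a product of functions of independent
coordinates, so its integral factorizes. -/
lemma pi_withDensity {g : Ω → ℝ≥0∞} (hg : Measurable g) [SigmaFinite (U.withDensity g)] :
    Measure.pi (fun _ : ι => U.withDensity g) =
      (Measure.pi fun _ : ι => U).withDensity fun x => ∏ i, g (x i) := by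
  refine Measure.pi_eq fun s hs => ?_
  rw [withDensity_apply _ (MeasurableSet.univ_pi hs), ← lintegral_indicator
    (MeasurableSet.univ_pi hs)]
  have e : ∀ x : ι → Ω, (Set.univ.pi s).indicator (fun x => ∏ i, g (x i)) x =
      ∏ i, (s i).indicator g (x i) := by
    intro x
    by_cases hx : x ∈ Set.univ.pi s
    · rw [Set.indicator_of_mem hx]
      exact Finset.prod_congr rfl fun i _ => (Set.indicator_of_mem (hx i trivial) g).symm
    · rw [Set.indicator_of_notMem hx]
      obtain ⟨i, hi⟩ : ∃ i, x i ∉ s i := by simpa using hx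
      exact (Finset.prod_eq_zero (Finset.mem_univ i) (Set.indicator_of_notMem hi g)).symm
  simp_rw [e]
  have hind : iIndepFun (fun (i : ι) (x : ι → Ω) => (s i).indicator g (x i))
      (Measure.pi fun _ : ι => U) :=
    iIndepFun_pi fun i => (hg.indicator (hs i)).aemeasurable
  rw [lintegral_prod_eq_prod_lintegral_of_indepFun _ _ hind
    fun i => (hg.indicator (hs i)).comp (measurable_pi_apply i)]
  refine Finset.prod_congr rfl fun i _ => ?_
  rw [withDensity_apply _ (hs i), ← lintegral_indicator (hs i)]
  exact (measurePreserving_eval (fun _ : ι => U) i).lintegral_comp (hg.indicator (hs i))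

/-- The log-likelihood ratio of product measures is the sum of the marginal log-densities. -/
lemma llr_pi_withDensity {g : Ω → ℝ} (hg : Measurable g) (hpos : ∀ ω, 0 < g ω) :
    llr (Measure.pi fun _ : ι => U.withDensity fun ω => ENNReal.ofReal (g ω))
      (Measure.pi fun _ : ι => U) =ᵐ[Measure.pi fun _ : ι => U]
      fun x => ∑ i, Real.log (g (x i)) := by
  have : SigmaFinite (U.withDensity fun ω => ENNReal.ofReal (g ω)) :=
    SigmaFinite.withDensity_ofReal _
  have hm : Measurable fun ω => ENNReal.ofReal (g ω) := by fun_prop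
  rw [pi_withDensity hm]
  filter_upwards [Measure.rnDeriv_withDensity (Measure.pi fun _ : ι => U)
    (f := fun x : ι → Ω => ∏ i, ENNReal.ofReal (g (x i)))
    (Finset.measurable_fun_prod _ fun i _ => hm.comp (measurable_pi_apply i))] with x hx
  rw [llr, hx, ENNReal.toReal_prod, Real.log_prod fun i _ => ?_]
  · simp [ENNReal.toReal_ofReal (hpos _).le]
  · simpa [ENNReal.toReal_ofReal (hpos _).le] using (hpos _).ne'

/-- Chebyshev's inequality for sums of independent copies of a centered bounded variable. -/
lemma measure_pi_le_abs_sum_le {n : ℕ} {Y : Ω → ℝ} (hY : Measurable Y) (h0 : ∫ ω, Y ω ∂U = 0)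
    {B : ℝ} (hB : ∀ ω, |Y ω| ≤ B) {ε : ℝ} (hε : 0 < ε) :
    (Measure.pi fun _ : Fin n => U) {x | ε ≤ |∑ i, Y (x i)|} ≤
      ENNReal.ofReal (n * B ^ 2 / ε ^ 2) := by
  have hL : MemLp Y 2 U := MemLp.of_bound hY.aestronglyMeasurable B (ae_of_all _ hB)
  have hL' : MemLp (∑ i : Fin n, fun x : Fin n → Ω => Y (x i)) 2 (Measure.pi fun _ => U) :=
    memLp_finsetSum' _ fun i _ => hL.comp_measurePreserving (measurePreserving_eval _ i)
  have hmean : ∫ x, (∑ i : Fin n, fun x : Fin n → Ω => Y (x i)) x ∂(Measure.pi fun _ => U) = 0 := by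
    have hi : ∀ i : Fin n, Integrable (fun x : Fin n → Ω => Y (x i)) (Measure.pi fun _ => U) :=
      fun i => (hL.comp_measurePreserving (measurePreserving_eval _ i)).integrable (by norm_num)
    simp only [Finset.sum_apply]
    rw [integral_finsetSum _ fun i _ => hi i]
    refine Finset.sum_eq_zero fun i _ => ?_
    rw [← h0]
    exact integral_comp_eval (μ := fun _ : Fin n => U) (i := i) hY.aestronglyMeasurable
  have h := meas_ge_le_variance_div_sq hL' hε
  rw [hmean] at h
  simp only [sub_zero, Finset.sum_apply] at h
  refine h.trans (ENNReal.ofReal_le_ofReal ?_)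
  have hv := variance_sum_pi (μ := fun _ : Fin n => U) (X := fun _ => Y) fun _ => hL
  rw [hv]
  have hvar : Var[Y; U] ≤ B ^ 2 := by
    rw [variance_of_integral_eq_zero hY.aemeasurable h0]
    calc ∫ ω, Y ω ^ 2 ∂U ≤ ∫ _, B ^ 2 ∂U :=
          integral_mono hL.integrable_sq (integrable_const _) fun ω => sq_le_sq' (by
            linarith [neg_le_of_abs_le (hB ω)]) (le_of_abs_le (hB ω))
      _ = B ^ 2 := by simp
  gcongr
  simpa using mul_le_mul_of_nonneg_left hvar (Nat.cast_nonneg n)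

end Product

/-! ### Axial densities relative to uniformity and their normalization -/

section Axial

variable {p : ℕ} {f : ℝ → ℝ}

/-- The mean of `f ((x'ϑ) ^ 2)` under the uniform distribution on the sphere. -/
noncomputable def uniformMean (f : ℝ → ℝ) (ϑ : EuclideanSpace ℝ (Fin p)) : ℝ :=
  ∫ x, f ((inner ℝ (x : EuclideanSpace ℝ (Fin p)) ϑ) ^ 2) ∂uniformSphere p

lemma inner_sq_le_norm_sq (x : UnitSphere p) (ϑ : EuclideanSpace ℝ (Fin p)) :
    (inner ℝ (x : EuclideanSpace ℝ (Fin p)) ϑ) ^ 2 ≤ ‖ϑ‖ ^ 2 := by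
  have h := abs_real_inner_le_norm (x : EuclideanSpace ℝ (Fin p)) ϑ
  rw [norm_eq_of_mem_sphere x, one_mul] at h
  rw [← sq_abs]
  gcongr

/-- Only nonnegative arguments of `f` occur in the densities. This bound makes every density
positive and every normalizing mean at least `1`, so the logarithms are harmless for all `ϑ`. -/
lemma IsAngularFunction.one_le (hf : IsAngularFunction f) {z : ℝ} (hz : 0 ≤ z) : 1 ≤ f z :=
  hf.map_zero ▸ hf.monotone hz

lemma IsAngularFunction.measurable_comp_inner_sq (hf : IsAngularFunction f)
    (ϑ : EuclideanSpace ℝ (Fin p)) :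
    Measurable fun x : UnitSphere p => f ((inner ℝ (x : EuclideanSpace ℝ (Fin p)) ϑ) ^ 2) :=
  hf.monotone.measurable.comp (by fun_prop)

variable [hp : Fact (2 ≤ p)]

lemma IsAngularFunction.integrable_comp_inner_sq (hf : IsAngularFunction f)
    (ϑ : EuclideanSpace ℝ (Fin p)) :
    Integrable (fun x : UnitSphere p => f ((inner ℝ (x : EuclideanSpace ℝ (Fin p)) ϑ) ^ 2))
      (uniformSphere p) := by
  refine Integrable.of_bound (hf.measurable_comp_inner_sq ϑ).aestronglyMeasurable (f (‖ϑ‖ ^ 2))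
    (ae_of_all _ fun x => ?_)
  rw [Real.norm_of_nonneg (hf.nonneg _)]
  exact hf.monotone (inner_sq_le_norm_sq x ϑ)

lemma IsAngularFunction.one_le_uniformMean (hf : IsAngularFunction f)
    (ϑ : EuclideanSpace ℝ (Fin p)) : 1 ≤ uniformMean f ϑ := by
  calc (1 : ℝ) = ∫ _, 1 ∂uniformSphere p := by simp
    _ ≤ _ := integral_mono (integrable_const _) (hf.integrable_comp_inner_sq ϑ)
      fun x => hf.one_le (sq_nonneg _)

lemma surfaceMeasure_univ_ne_zero : surfaceMeasure p Set.univ ≠ 0 := by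
  have : NeZero p := ⟨by have := hp.out; omega⟩
  rw [Ne, Measure.measure_univ_eq_zero]
  exact Measure.toSphere_ne_zero _

lemma surfaceMeasure_eq_smul_uniformSphere :
    surfaceMeasure p = surfaceMeasure p Set.univ • uniformSphere p := by
  rw [uniformSphere, smul_smul, ENNReal.mul_inv_cancel surfaceMeasure_univ_ne_zero
    (measure_ne_top _ _), one_smul]

/-- The normalizing constant in terms of the uniform mean. -/
lemma IsAngularFunction.surfaceMeasure_mul_uniformMean (hf : IsAngularFunction f)
    {θ : EuclideanSpace ℝ (Fin p)} (hθ : ‖θ‖ = 1) (r : ℝ) :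
    (surfaceMeasure p Set.univ).toReal * uniformMean f (r • θ) =
      2 * Real.pi ^ (((p : ℝ) - 1) / 2) / Real.Gamma (((p : ℝ) - 1) / 2) *
        ∫ s in (-1 : ℝ)..1, (1 - s ^ 2) ^ (((p : ℝ) - 3) / 2) * f (r ^ 2 * s ^ 2) := by
  have hp2 : (2 : ℝ) ≤ p := by exact_mod_cast hp.out
  have hC : 0 ≤ 2 * Real.pi ^ (((p : ℝ) - 1) / 2) / Real.Gamma (((p : ℝ) - 1) / 2) := by
    have := Real.Gamma_pos_of_pos (show 0 < ((p : ℝ) - 1) / 2 by linarith)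
    positivity
  have hfm : Measurable fun s : ℝ => f (r ^ 2 * s ^ 2) := hf.monotone.measurable.comp (by fun_prop)
  have hwm : Measurable fun s : ℝ => (1 - s ^ 2) ^ (((p : ℝ) - 3) / 2) := by fun_prop
  have h := lintegral_surfaceMeasure_inner hp.out hθ
    (G := fun s => ENNReal.ofReal (f (r ^ 2 * s ^ 2))) hfm.ennreal_ofReal
  have hL : ∫⁻ x, ENNReal.ofReal (f (r ^ 2 * (inner ℝ (x : EuclideanSpace ℝ (Fin p)) θ) ^ 2))
      ∂surfaceMeasure p =
      surfaceMeasure p Set.univ * ENNReal.ofReal (uniformMean f (r • θ)) := by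
    conv_lhs => rw [surfaceMeasure_eq_smul_uniformSphere]
    rw [lintegral_smul_measure, uniformMean,
      ofReal_integral_eq_lintegral_ofReal (hf.integrable_comp_inner_sq _)
        (ae_of_all _ fun x => hf.nonneg _)]
    simp [inner_smul_right, mul_pow]
  have hnn : ∀ s ∈ Set.Ioo (-1 : ℝ) 1, 0 ≤ (1 - s ^ 2) ^ (((p : ℝ) - 3) / 2) := fun s hs =>
    Real.rpow_nonneg (by nlinarith [hs.1, hs.2]) _
  have hR : ∫ s in (-1 : ℝ)..1, (1 - s ^ 2) ^ (((p : ℝ) - 3) / 2) * f (r ^ 2 * s ^ 2) =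
      (∫⁻ s in Set.Ioo (-1 : ℝ) 1, ENNReal.ofReal ((1 - s ^ 2) ^ (((p : ℝ) - 3) / 2)) *
        ENNReal.ofReal (f (r ^ 2 * s ^ 2))).toReal := by
    rw [intervalIntegral.integral_of_le (by norm_num), integral_Ioc_eq_integral_Ioo,
      integral_eq_lintegral_of_nonneg_ae]
    · congr 1
      refine setLIntegral_congr_fun measurableSet_Ioo fun s hs => ?_
      exact ENNReal.ofReal_mul (hnn s hs)
    · filter_upwards [ae_restrict_mem measurableSet_Ioo] with s hs
      exact mul_nonneg (hnn s hs) (hf.nonneg _)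
    · exact (hwm.mul hfm).aestronglyMeasurable
  have h' := congrArg ENNReal.toReal (hL.symm.trans h)
  rw [ENNReal.toReal_mul, ENNReal.toReal_mul, ENNReal.toReal_ofReal hC, ENNReal.toReal_ofReal
    (zero_le_one.trans (hf.one_le_uniformMean _)), ← hR] at h'
  exact h'

/-- The density of the axial distributions with respect to the uniform distribution. -/
lemma flatLaw_eq_withDensity (hf : IsAngularFunction f) (ϑ : EuclideanSpace ℝ (Fin p)) :
    flatLaw ϑ f = (uniformSphere p).withDensity fun x => ENNReal.ofReal
      (f ((inner ℝ (x : EuclideanSpace ℝ (Fin p)) ϑ) ^ 2) / uniformMean f ϑ) := by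
  have hm := hf.measurable_comp_inner_sq ϑ
  -- The null vector has to be covered as well, since `τ n` may vanish for some `n`; there the
  -- density is constantly `1`.
  by_cases hϑ : ϑ = 0
  · rw [flatLaw, if_pos hϑ, hϑ]
    simp [uniformMean, hf.map_zero]
  have hn : ‖ϑ‖ ≠ 0 := norm_ne_zero_iff.2 hϑ
  have hθ : ‖‖ϑ‖⁻¹ • ϑ‖ = 1 := by rw [norm_smul, norm_inv, norm_norm, inv_mul_cancel₀ hn]
  have key := hf.surfaceMeasure_mul_uniformMean hθ ‖ϑ‖
  rw [smul_inv_smul₀ hn] at key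
  have hT : 0 < (surfaceMeasure p Set.univ).toReal :=
    ENNReal.toReal_pos surfaceMeasure_univ_ne_zero (measure_ne_top _ _)
  have hZ : 0 < uniformMean f ϑ := zero_lt_one.trans_le (hf.one_le_uniformMean ϑ)
  rw [flatLaw, if_neg hϑ, axialLaw]
  conv_lhs => rw [surfaceMeasure_eq_smul_uniformSphere]
  rw [withDensity_smul_measure, ← withDensity_smul]
  · congr 1
    ext x
    rw [Pi.smul_apply, smul_eq_mul]
    conv_lhs => rw [← ENNReal.ofReal_toReal (measure_ne_top (surfaceMeasure p) Set.univ)]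
    rw [← ENNReal.ofReal_mul hT.le]
    congr 1
    have hI : ∫ s in (-1 : ℝ)..1, (1 - s ^ 2) ^ (((p : ℝ) - 3) / 2) * f (‖ϑ‖ ^ 2 * s ^ 2) ≠ 0 := by
      intro h0
      rw [h0, mul_zero] at key
      exact (mul_pos hT hZ).ne' key
    have hG : Real.Gamma (((p : ℝ) - 1) / 2) ≠ 0 := by
      have hp2 : (2 : ℝ) ≤ p := by exact_mod_cast hp.out
      exact (Real.Gamma_pos_of_pos (by linarith)).ne'
    have hpi : Real.pi ^ (((p : ℝ) - 1) / 2) ≠ 0 := (Real.rpow_pos_of_pos Real.pi_pos _).ne'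
    have hinner : ‖ϑ‖ ^ 2 * (inner ℝ (x : EuclideanSpace ℝ (Fin p)) (‖ϑ‖⁻¹ • ϑ)) ^ 2 =
        (inner ℝ (x : EuclideanSpace ℝ (Fin p)) ϑ) ^ 2 := by
      rw [inner_smul_right]
      field_simp
    rw [axialDensity, hinner, axialConst]
    generalize (∫ s in (-1 : ℝ)..1,
      (1 - s ^ 2) ^ (((p : ℝ) - 3) / 2) * f (‖ϑ‖ ^ 2 * s ^ 2)) = I at key hI ⊢
    field_simp at key ⊢
    linear_combination f ((inner ℝ (x : EuclideanSpace ℝ (Fin p)) ϑ) ^ 2) * key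
  · refine Measurable.ennreal_ofReal (Measurable.const_mul ?_ _)
    exact hf.monotone.measurable.comp (by fun_prop)

/-- The log-likelihood ratio of the axial model with respect to uniformity. -/
lemma llr_altLaw (hf : IsAngularFunction f) (n : ℕ) (ϑ : EuclideanSpace ℝ (Fin p)) :
    llr (altLaw n ϑ f) (nullLaw p n) =ᵐ[nullLaw p n] fun x =>
      ∑ i, Real.log (f ((inner ℝ (x i : EuclideanSpace ℝ (Fin p)) ϑ) ^ 2)) -
        n * Real.log (uniformMean f ϑ) := by
  have hZ : 0 < uniformMean f ϑ := zero_lt_one.trans_le (hf.one_le_uniformMean ϑ)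
  have hpos : ∀ x : UnitSphere p, 0 < f ((inner ℝ (x : EuclideanSpace ℝ (Fin p)) ϑ) ^ 2) :=
    fun x => zero_lt_one.trans_le (hf.one_le (sq_nonneg _))
  have h := llr_pi_withDensity (ι := Fin n) (U := uniformSphere p)
    ((hf.measurable_comp_inner_sq ϑ).div_const (uniformMean f ϑ))
    fun x => div_pos (hpos x) hZ
  rw [altLaw, flatLaw_eq_withDensity hf]
  filter_upwards [h] with x hx
  rw [hx]
  simp [Real.log_div (hpos _).ne' hZ.ne']

/-- Expansion of the logarithm of the normalizing constant for small concentrations. -/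
lemma log_uniformMean_isLittleO (hf : IsAngularFunction f)
    {ϑ : ℕ → EuclideanSpace ℝ (Fin p)} (hϑ : Tendsto (fun n => ‖ϑ n‖ ^ 2) atTop (𝓝 0)) :
    (fun n => Real.log (uniformMean f (ϑ n)) - ‖ϑ n‖ ^ 2 / p -
      (deriv (deriv f) 0 / 2 * (3 / ((p : ℝ) * (p + 2))) - 1 / (2 * (p : ℝ) ^ 2)) *
        (‖ϑ n‖ ^ 2) ^ 2) =o[atTop] fun n => (‖ϑ n‖ ^ 2) ^ 2 := by
  set k : ℕ → ℝ := fun n => ‖ϑ n‖ ^ 2 with hk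
  set a := deriv (deriv f) 0 with ha
  set m : ℝ := 3 / ((p : ℝ) * (p + 2)) with hm
  set y : ℕ → ℝ := fun n => uniformMean f (ϑ n) - 1 with hy
  -- The Taylor bound for `f` is uniform over the sphere because `(x'ϑ)² ≤ k`, so it can be
  -- integrated term by term against the second and fourth moments.
  have h1 : (fun n => y n - k n / p - a / 2 * m * k n ^ 2) =o[atTop] fun n => k n ^ 2 := by
    have hT := sub_taylor_two_isLittleO hf.differentiableAt_near hf.differentiableAt_deriv
    rw [hf.map_zero, hf.deriv_zero] at hT
    rw [isLittleO_iff] at hT ⊢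
    intro c hc
    obtain ⟨δ, hδ, hball⟩ := Metric.eventually_nhds_iff.1 (hT hc)
    filter_upwards [hϑ.eventually (gt_mem_nhds hδ)] with n hn
    have i0 := hf.integrable_comp_inner_sq (ϑ n)
    have i1 : Integrable (fun _ : UnitSphere p => (1 : ℝ)) (uniformSphere p) := integrable_const _
    have i2 : Integrable (fun x : UnitSphere p =>
        (inner ℝ (x : EuclideanSpace ℝ (Fin p)) (ϑ n)) ^ 2) (uniformSphere p) :=
      Continuous.integrable_uniformSphere (by fun_prop)
    have i4 : Integrable (fun x : UnitSphere p =>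
        a / 2 * (inner ℝ (x : EuclideanSpace ℝ (Fin p)) (ϑ n)) ^ 4) (uniformSphere p) :=
      Continuous.integrable_uniformSphere (by fun_prop)
    have i01 : Integrable (fun x : UnitSphere p =>
        f ((inner ℝ (x : EuclideanSpace ℝ (Fin p)) (ϑ n)) ^ 2) - 1) (uniformSphere p) := i0.sub i1
    have i012 : Integrable (fun x : UnitSphere p =>
        f ((inner ℝ (x : EuclideanSpace ℝ (Fin p)) (ϑ n)) ^ 2) - 1 -
          (inner ℝ (x : EuclideanSpace ℝ (Fin p)) (ϑ n)) ^ 2) (uniformSphere p) := i01.sub i2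
    have e : y n - k n / p - a / 2 * m * k n ^ 2 = ∫ x : UnitSphere p,
        (f ((inner ℝ (x : EuclideanSpace ℝ (Fin p)) (ϑ n)) ^ 2) - 1 -
          (inner ℝ (x : EuclideanSpace ℝ (Fin p)) (ϑ n)) ^ 2 -
          a / 2 * (inner ℝ (x : EuclideanSpace ℝ (Fin p)) (ϑ n)) ^ 4) ∂uniformSphere p := by
      rw [integral_sub i012 i4, integral_sub i01 i2, integral_sub i0 i1, integral_const_mul,
        integral_inner_sq, integral_inner_pow_four]
      simp only [hy, hk, uniformMean, hm]
      simp
      ring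
    rw [e]
    refine (norm_integral_le_of_norm_le_const (C := c * k n ^ 2) (ae_of_all _ fun x => ?_)).trans
      (by simp)
    have hle := inner_sq_le_norm_sq x (ϑ n)
    have hb := hball (y := (inner ℝ (x : EuclideanSpace ℝ (Fin p)) (ϑ n)) ^ 2) (by
      rw [Real.dist_eq, sub_zero, abs_of_nonneg (sq_nonneg _)]
      exact hle.trans_lt hn)
    rw [one_mul, Real.norm_of_nonneg (sq_nonneg _)] at hb
    refine (le_of_eq ?_).trans (hb.trans (by gcongr))
    congr 1
    ring
  have hk1 : (fun n => k n ^ 2) =o[atTop] k := by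
    have : k =o[atTop] fun _ => (1 : ℝ) := (isLittleO_one_iff ℝ).2 hϑ
    simpa [sq] using this.mul_isBigO (isBigO_refl k atTop)
  have hd : (fun n => y n - k n / p) =o[atTop] k := by
    have h2 := (h1.trans hk1).add (hk1.const_mul_left (a / 2 * m))
    refine h2.congr_left fun n => by ring
  have hkp : (fun n => k n / p) =O[atTop] k := by
    refine ((isBigO_refl k atTop).const_mul_left ((p : ℝ)⁻¹)).congr_left fun n => by ring
  have hyO : y =O[atTop] k := (hd.isBigO.add hkp).congr_left fun n => by ring
  have hy0 : Tendsto y atTop (𝓝 0) := hyO.trans_tendsto hϑ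
  have h3 := (log_one_add_sub_isLittleO.comp_tendsto hy0).trans_isBigO (hyO.pow 2)
  -- Difference of squares: `y - k / p = o(k)` and `y + k / p = O(k)`. This supplies the `-1 / (2
  -- p²)` contributed by `-y² / 2` in `log (1 + y)`.
  have h4 : (fun n => y n ^ 2 - (k n / p) ^ 2) =o[atTop] fun n => k n ^ 2 := by
    have := hd.mul_isBigO (hyO.add hkp)
    refine this.congr (fun n => by ring) fun n => by ring
  have h5 := (h3.add h1).sub (h4.const_mul_left (1 / 2))
  refine h5.congr_left fun n => ?_
  simp only [Function.comp, hy, add_sub_cancel]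
  ring

end Axial

/-! ### Scores, information matrix and the quadratic expansion -/

section LocalAsymptoticNormality

variable {p : ℕ}

/-- The contribution `p vec (x x' - I / p)` of one observation to the central sequence. -/
noncomputable def score (x : UnitSphere p) : EuclideanSpace ℝ (Fin p × Fin p) :=
  WithLp.toLp 2 ((p : ℝ) • vec (vecMulVec (x : EuclideanSpace ℝ (Fin p)).ofLp
    (x : EuclideanSpace ℝ (Fin p)).ofLp - (1 / (p : ℝ)) • (1 : Matrix (Fin p) (Fin p) ℝ)))

lemma score_apply (x : UnitSphere p) (q : Fin p × Fin p) :
    score x q = p * ((x : EuclideanSpace ℝ (Fin p)) q.1 * (x : EuclideanSpace ℝ (Fin p)) q.2 -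
      (if q.1 = q.2 then 1 else 0) / p) := by
  simp only [score, Pi.smul_apply, vec, Matrix.sub_apply, Matrix.smul_apply, vecMulVec_apply,
    one_apply, smul_eq_mul, eq_comm (a := q.2)]
  ring

lemma continuous_score : Continuous (score : UnitSphere p → _) := by
  refine (PiLp.continuous_toLp 2 _).comp (continuous_pi fun q => ?_)
  have h := fun x : UnitSphere p => score_apply x q
  simp only [score] at h
  simp_rw [h]
  fun_prop

lemma centralSeq_eq_sum_score {n : ℕ} (x : Fin n → UnitSphere p) :
    centralSeq x = (√(n : ℝ))⁻¹ • ∑ i, score (x i) := by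
  ext q
  rcases Nat.eq_zero_or_pos n with rfl | hn
  · simp [centralSeq]
  have hn' : (0 : ℝ) < n := by exact_mod_cast hn
  have hs : √(n : ℝ) ≠ 0 := (Real.sqrt_pos.2 hn').ne'
  have hsq : √(n : ℝ) ^ 2 = n := Real.sq_sqrt hn'.le
  simp only [PiLp.smul_apply, WithLp.ofLp_sum, Finset.sum_apply, score_apply, smul_eq_mul,
    ← Finset.mul_sum, Finset.sum_sub_distrib]
  simp only [centralSeq, sampleCov, Pi.smul_apply, vec, Matrix.sub_apply, Matrix.smul_apply,
    vecMulVec_apply, one_apply, smul_eq_mul, Matrix.sum_apply, eq_comm (a := q.2),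
    Finset.sum_const, Finset.card_univ, Fintype.card_fin, nsmul_eq_mul]
  simp_rw [mul_comm ((x _ : EuclideanSpace ℝ (Fin p)) q.2)]
  field_simp
  rw [hsq]

/-- This exact identity is why the first-order part of the log-likelihood ratio is linear in the
central sequence without remainder. -/
lemma vecOuter_dotProduct_score (t : EuclideanSpace ℝ (Fin p)) (x : UnitSphere p) (hp0 : p ≠ 0) :
    vecOuter t ⬝ᵥ (score x).ofLp =
      p * (inner ℝ (x : EuclideanSpace ℝ (Fin p)) t) ^ 2 - ‖t‖ ^ 2 := by
  have hp' : (p : ℝ) ≠ 0 := by exact_mod_cast hp0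
  have h1 : inner ℝ (x : EuclideanSpace ℝ (Fin p)) t =
      ∑ i, t i * (x : EuclideanSpace ℝ (Fin p)) i := by
    simp [PiLp.inner_apply]
  rw [h1, EuclideanSpace.real_norm_sq_eq, sq, Finset.sum_mul_sum]
  simp only [dotProduct, Fintype.sum_prod_type, score_apply, vecOuter, vec, vecMulVec_apply]
  rw [Finset.mul_sum, ← Finset.sum_sub_distrib]
  refine Finset.sum_congr rfl fun i _ => ?_
  have h2 : t i ^ 2 = ∑ j, if i = j then t j * t i else 0 := by simp [sq]
  rw [Finset.mul_sum, h2, ← Finset.sum_sub_distrib]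
  refine Finset.sum_congr rfl fun j _ => ?_
  split_ifs <;> field_simp
  ring

variable [hp : Fact (2 ≤ p)]

lemma integral_coord_mul_coord (i j : Fin p) :
    ∫ x, (x : EuclideanSpace ℝ (Fin p)) i * (x : EuclideanSpace ℝ (Fin p)) j ∂uniformSphere p =
      (if i = j then 1 else 0) / p := by
  have h := integral_inner_mul_inner (EuclideanSpace.single i (1 : ℝ)) (EuclideanSpace.single j 1)
  simpa [EuclideanSpace.inner_single_right, Pi.single_apply, eq_comm] using h

lemma integral_score (q : Fin p × Fin p) : ∫ x, score x q ∂uniformSphere p = 0 := by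
  simp_rw [score_apply]
  rw [integral_const_mul, integral_sub (Continuous.integrable_uniformSphere (by fun_prop))
    (integrable_const _), integral_coord_mul_coord]
  simp

/-- Of the three pairings in the fourth moment, two give the identity and `K_p`. The third gives
`J_p` with weight `p / (p + 2)`, which centering lowers by `1` to `-2 / (p + 2)`. -/
lemma integral_score_mul_score (q r : Fin p × Fin p) :
    ∫ x, score x q * score x r ∂uniformSphere p = infoMatrix p q r := by
  have hp0 : (0 : ℝ) < p := by have := hp.out; positivity
  have h4 : ∀ i j k l : Fin p, ∫ x, (x : EuclideanSpace ℝ (Fin p)) i *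
      (x : EuclideanSpace ℝ (Fin p)) j * ((x : EuclideanSpace ℝ (Fin p)) k *
      (x : EuclideanSpace ℝ (Fin p)) l) ∂uniformSphere p =
      ((if i = j then 1 else 0) * (if k = l then 1 else 0) +
        (if i = k then 1 else 0) * (if j = l then 1 else 0) +
        (if i = l then 1 else 0) * (if j = k then 1 else 0)) / ((p : ℝ) * (p + 2)) := by
    intro i j k l
    have h := integral_inner_mul_inner_mul_inner_mul_inner (EuclideanSpace.single i (1 : ℝ))
      (EuclideanSpace.single j 1) (EuclideanSpace.single k 1) (EuclideanSpace.single l 1)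
    simpa [EuclideanSpace.inner_single_right, Pi.single_apply, eq_comm] using h
  have e : ∀ x : UnitSphere p, score x q * score x r =
      (p : ℝ) ^ 2 * (((x : EuclideanSpace ℝ (Fin p)) q.1 * (x : EuclideanSpace ℝ (Fin p)) q.2 *
        ((x : EuclideanSpace ℝ (Fin p)) r.1 * (x : EuclideanSpace ℝ (Fin p)) r.2) -
        (if r.1 = r.2 then 1 else 0) / p *
          ((x : EuclideanSpace ℝ (Fin p)) q.1 * (x : EuclideanSpace ℝ (Fin p)) q.2)) -
        ((if q.1 = q.2 then 1 else 0) / p *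
          ((x : EuclideanSpace ℝ (Fin p)) r.1 * (x : EuclideanSpace ℝ (Fin p)) r.2) -
        (if q.1 = q.2 then 1 else 0) / p * ((if r.1 = r.2 then 1 else 0) / p))) := by
    intro x
    rw [score_apply, score_apply]
    ring
  simp_rw [e]
  rw [integral_const_mul, integral_sub (Continuous.integrable_uniformSphere (by fun_prop))
    (Continuous.integrable_uniformSphere (by fun_prop)),
    integral_sub (Continuous.integrable_uniformSphere (by fun_prop))
    (Continuous.integrable_uniformSphere (by fun_prop)),
    integral_sub (Continuous.integrable_uniformSphere (by fun_prop)) (integrable_const _),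
    integral_const_mul, integral_const_mul, h4, integral_coord_mul_coord,
    integral_coord_mul_coord]
  have hK : commutationMatrix p q r =
      (if q.1 = r.2 then 1 else 0) * (if q.2 = r.1 then 1 else 0) := by
    simp only [commutationMatrix, Matrix.sum_apply, kroneckerMap_apply, single_apply]
    rw [Finset.sum_eq_single q.1, Finset.sum_eq_single q.2]
    · by_cases h1 : q.1 = r.2 <;> by_cases h2 : q.2 = r.1 <;> simp [h1, h2]
    · intro j _ hj
      simp [hj]
    · simp
    · intro i _ hi
      simp [hi]
    · simp
  have h1 : (1 : Matrix (Fin p × Fin p) (Fin p × Fin p) ℝ) q r =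
      (if q.1 = r.1 then 1 else 0) * (if q.2 = r.2 then 1 else 0) := by
    rw [one_apply]
    by_cases h1 : q.1 = r.1 <;> by_cases h2 : q.2 = r.2 <;> simp [h1, h2, Prod.ext_iff]
  simp only [infoMatrix, Matrix.smul_apply, Matrix.sub_apply, Matrix.add_apply, hK, h1, jMatrix, vecMulVec_apply, vec,
    one_apply, smul_eq_mul, integral_const, probReal_univ, one_mul, eq_comm (a := q.2) (b := q.1),
    eq_comm (a := r.2) (b := r.1)]
  field_simp
  ring

lemma memLp_score : MemLp (score : UnitSphere p → _) 2 (uniformSphere p) :=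
  continuous_score.memLp_of_hasCompactSupport (HasCompactSupport.of_compactSpace _)

/-- The quadratic form is computed as the variance of `p (x't)² - ‖t‖²`, which avoids expanding the
matrix. -/
lemma vecOuter_dotProduct_infoMatrix (t : EuclideanSpace ℝ (Fin p)) :
    vecOuter t ⬝ᵥ (infoMatrix p *ᵥ vecOuter t) =
      (p : ℝ) ^ 2 * (3 / ((p : ℝ) * (p + 2)) - 1 / (p : ℝ) ^ 2) * ‖t‖ ^ 4 := by
  have hp0 : (0 : ℝ) < p := by have := hp.out; positivity
  have h := integral_inner_sq_eq memLp_score integral_score_mul_score (WithLp.toLp 2 (vecOuter t))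
  simp only at h
  rw [← h]
  have e : ∀ x : UnitSphere p, inner ℝ (score x) (WithLp.toLp 2 (vecOuter t)) ^ 2 =
      ((p : ℝ) ^ 2 * (inner ℝ (x : EuclideanSpace ℝ (Fin p)) t) ^ 4 -
        2 * p * ‖t‖ ^ 2 * (inner ℝ (x : EuclideanSpace ℝ (Fin p)) t) ^ 2) + ‖t‖ ^ 4 := by
    intro x
    have : inner ℝ (score x) (WithLp.toLp 2 (vecOuter t)) = vecOuter t ⬝ᵥ (score x).ofLp := by
      simp [PiLp.inner_apply, dotProduct]
    rw [this, vecOuter_dotProduct_score t x (by exact_mod_cast hp0.ne')]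
    ring
  simp_rw [e]
  rw [integral_add (Continuous.integrable_uniformSphere (by fun_prop)) (integrable_const _),
    integral_sub (Continuous.integrable_uniformSphere (by fun_prop))
    (Continuous.integrable_uniformSphere (by fun_prop)), integral_const_mul, integral_const_mul,
    integral_inner_sq, integral_inner_pow_four]
  simp
  field_simp
  ring

/-- The central sequence is asymptotically normal under uniformity. -/
lemma tendstoInDistribution_centralSeq :
    TendstoInDistribution (fun (n : ℕ) (x : Fin n → UnitSphere p) => centralSeq x) atTop
      (id : EuclideanSpace ℝ (Fin p × Fin p) → EuclideanSpace ℝ (Fin p × Fin p))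
      (fun n : ℕ => nullLaw p n) (multivariateGaussian 0 (infoMatrix p)) := by
  simp_rw [centralSeq_eq_sum_score]
  exact tendstoInDistribution_inv_sqrt_smul_sum_pi continuous_score.measurable memLp_score
    integral_score integral_score_mul_score

/-- Exact decomposition of the error in the quadratic expansion of the log-likelihood ratio. -/
lemma llr_sub_quadratic_eq {f : ℝ → ℝ} (hf : IsAngularFunction f) {n : ℕ} (hn : 0 < n)
    {t ϑ : EuclideanSpace ℝ (Fin p)} (hϑ : ϑ = √((p : ℝ) / √(n : ℝ)) • t) :
    (fun x => llr (altLaw n ϑ f) (nullLaw p n) x - (vecOuter t ⬝ᵥ (centralSeq x).ofLp -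
        (1 / 2) * (vecOuter t ⬝ᵥ (infoMatrix p *ᵥ vecOuter t)))) =ᵐ[nullLaw p n] fun x =>
      ∑ i, (Real.log (f ((inner ℝ (x i : EuclideanSpace ℝ (Fin p)) ϑ) ^ 2)) -
          (inner ℝ (x i : EuclideanSpace ℝ (Fin p)) ϑ) ^ 2 -
          (deriv (deriv f) 0 - 1) / 2 * ((inner ℝ (x i : EuclideanSpace ℝ (Fin p)) ϑ) ^ 2) ^ 2) +
        (deriv (deriv f) 0 - 1) / 2 *
          ∑ i, ((inner ℝ (x i : EuclideanSpace ℝ (Fin p)) ϑ) ^ 4 -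
            3 / ((p : ℝ) * (p + 2)) * ‖ϑ‖ ^ 4) -
        n * (Real.log (uniformMean f ϑ) - ‖ϑ‖ ^ 2 / p -
          (deriv (deriv f) 0 / 2 * (3 / ((p : ℝ) * (p + 2))) - 1 / (2 * (p : ℝ) ^ 2)) *
            (‖ϑ‖ ^ 2) ^ 2) := by
  have hp0 : (0 : ℝ) < p := by have := hp.out; positivity
  have hn' : (0 : ℝ) < n := by exact_mod_cast hn
  have hs : 0 < √(n : ℝ) := Real.sqrt_pos.2 hn'
  have hsq : √(n : ℝ) ^ 2 = n := Real.sq_sqrt hn'.le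
  have hr : √((p : ℝ) / √(n : ℝ)) ^ 2 = p / √(n : ℝ) := Real.sq_sqrt (by positivity)
  have hnorm : ‖ϑ‖ ^ 2 = p / √(n : ℝ) * ‖t‖ ^ 2 := by
    rw [hϑ, norm_smul, mul_pow, Real.norm_of_nonneg (Real.sqrt_nonneg _), hr]
  have hn4 : (n : ℝ) * (‖ϑ‖ ^ 2) ^ 2 = p ^ 2 * ‖t‖ ^ 4 := by
    rw [hnorm]
    field_simp
    rw [hsq]
  have hinner : ∀ x : UnitSphere p, (inner ℝ (x : EuclideanSpace ℝ (Fin p)) ϑ) ^ 2 =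
      p / √(n : ℝ) * (inner ℝ (x : EuclideanSpace ℝ (Fin p)) t) ^ 2 := by
    intro x
    rw [hϑ, inner_smul_right, mul_pow, hr]
  filter_upwards [llr_altLaw hf n ϑ] with x hx
  have hc : vecOuter t ⬝ᵥ (centralSeq x).ofLp =
      ∑ i, (inner ℝ (x i : EuclideanSpace ℝ (Fin p)) ϑ) ^ 2 - n * (‖ϑ‖ ^ 2 / p) := by
    rw [centralSeq_eq_sum_score, WithLp.ofLp_smul, dotProduct_smul, WithLp.ofLp_sum,
      dotProduct_sum]
    simp_rw [vecOuter_dotProduct_score t _ (by exact_mod_cast hp0.ne'), hinner, hnorm]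
    rw [Finset.sum_sub_distrib, ← Finset.mul_sum, ← Finset.mul_sum]
    simp
    field_simp
  rw [hx, hc, vecOuter_dotProduct_infoMatrix]
  simp only [Finset.sum_sub_distrib, ← Finset.mul_sum, Finset.sum_const, Finset.card_univ,
    Fintype.card_fin, nsmul_eq_mul, ← pow_mul]
  -- The terms in `f''(0)` cancel between the sum and the normalizing constant. The rest matches the
  -- quadratic form because `n ‖ϑ‖⁴ = p² ‖t‖⁴` exactly.
  linear_combination (-(1 / 2) * (3 / ((p : ℝ) * (p + 2)) - 1 / (p : ℝ) ^ 2)) * hn4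

end LocalAsymptoticNormality

/-! ### Control of the three error terms -/

theorem mainTheorem3 (p : ℕ) [Fact (2 ≤ p)] (f : ℝ → ℝ) (hf : IsAngularFunction f)
    (τ : ℕ → EuclideanSpace ℝ (Fin p))
    (hτ : τ =O[atTop] (fun _ : ℕ => (1 : ℝ)))
    (hτ' : ¬ τ =o[atTop] (fun _ : ℕ => (1 : ℝ)))
    (ϑ : ℕ → EuclideanSpace ℝ (Fin p))
    (hϑ : ∀ n : ℕ, ϑ n = √((p : ℝ) / √(n : ℝ)) • τ n) :
    (∀ ε : ℝ, 0 < ε →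
      Tendsto (fun n : ℕ => nullLaw p n {x : Fin n → UnitSphere p |
        ε ≤ |llr (altLaw n (ϑ n) f) (nullLaw p n) x -
          (vecOuter (τ n) ⬝ᵥ (centralSeq x).ofLp -
            (1 / 2) * (vecOuter (τ n) ⬝ᵥ (infoMatrix p *ᵥ vecOuter (τ n))))|})
        atTop (𝓝 0)) ∧
    TendstoInDistribution (fun (n : ℕ) (x : Fin n → UnitSphere p) => centralSeq x) atTop
      (id : EuclideanSpace ℝ (Fin p × Fin p) → EuclideanSpace ℝ (Fin p × Fin p))
      (fun n : ℕ => nullLaw p n) (multivariateGaussian 0 (infoMatrix p)) := by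
  refine ⟨fun ε hε => ?_, tendstoInDistribution_centralSeq⟩
  set a := deriv (deriv f) 0 with ha
  set m : ℝ := 3 / ((p : ℝ) * (p + 2)) with hm
  have hm1 : 0 ≤ m := by positivity
  obtain ⟨C, hC0, hC⟩ := hτ.exists_pos
  have hC := hC.bound
  -- `n κ_n ^ 2` stays bounded and `κ_n` tends to zero.
  have hnk : ∀ᶠ n : ℕ in atTop, (n : ℝ) * (‖ϑ n‖ ^ 2) ^ 2 ≤ (p : ℝ) ^ 2 * C ^ 4 := by
    filter_upwards [hC, eventually_gt_atTop 0] with n hn hn0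
    have hn' : (0 : ℝ) < n := by exact_mod_cast hn0
    have hr : √((p : ℝ) / √(n : ℝ)) ^ 2 = p / √(n : ℝ) := Real.sq_sqrt (by positivity)
    have hsq : √(n : ℝ) ^ 2 = n := Real.sq_sqrt hn'.le
    rw [norm_one, mul_one] at hn
    have e : (n : ℝ) * (‖ϑ n‖ ^ 2) ^ 2 = p ^ 2 * ‖τ n‖ ^ 4 := by
      rw [hϑ, norm_smul, mul_pow, Real.norm_of_nonneg (Real.sqrt_nonneg _), hr]
      field_simp
      rw [hsq]
      ring
    rw [e]
    gcongr
  set B : ℝ := (p : ℝ) ^ 2 * C ^ 4 with hB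
  have hk4 : Tendsto (fun n => (‖ϑ n‖ ^ 2) ^ 2) atTop (𝓝 0) := by
    refine squeeze_zero' (Eventually.of_forall fun n => by positivity) ?_
      (tendsto_const_div_atTop_nhds_zero_nat B)
    filter_upwards [hnk, eventually_gt_atTop 0] with n hn hn0
    rw [le_div_iff₀ (by exact_mod_cast hn0), mul_comm]
    exact hn
  have hk : Tendsto (fun n => ‖ϑ n‖ ^ 2) atTop (𝓝 0) := by
    have := hk4.sqrt
    simpa [Real.sqrt_sq (sq_nonneg _)] using this
  -- A uniform bound on the remainder of the expansion of `log f`.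
  have hB1 : B + 1 ≠ 0 := by positivity
  -- Each of the three error terms will be at most `ε / 4`, for a total below `ε`. As `n ‖ϑ n‖⁴ ≤
  -- B`, this is the precision needed per observation; the `+ 1` keeps the denominator positive.
  have hε' : 0 < ε / (4 * (B + 1)) := by positivity
  have hr1 : ∀ᶠ n in atTop, ∀ x : Fin n → UnitSphere p,
      |∑ i, (Real.log (f ((inner ℝ (x i : EuclideanSpace ℝ (Fin p)) (ϑ n)) ^ 2)) -
        (inner ℝ (x i : EuclideanSpace ℝ (Fin p)) (ϑ n)) ^ 2 -
        (a - 1) / 2 * ((inner ℝ (x i : EuclideanSpace ℝ (Fin p)) (ϑ n)) ^ 2) ^ 2)| ≤ ε / 4 := by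
    have hT := (isLittleO_iff.1 (log_sub_taylor_two_isLittleO hf.differentiableAt_near
      hf.differentiableAt_deriv hf.map_zero hf.deriv_zero)) hε'
    obtain ⟨δ, hδ, hball⟩ := Metric.eventually_nhds_iff.1 hT
    filter_upwards [hk.eventually (gt_mem_nhds hδ), hnk] with n hn hnk x
    refine (Finset.abs_sum_le_sum_abs _ _).trans ?_
    have hi : ∀ i ∈ (Finset.univ : Finset (Fin n)),
        |Real.log (f ((inner ℝ (x i : EuclideanSpace ℝ (Fin p)) (ϑ n)) ^ 2)) -
          (inner ℝ (x i : EuclideanSpace ℝ (Fin p)) (ϑ n)) ^ 2 -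
          (a - 1) / 2 * ((inner ℝ (x i : EuclideanSpace ℝ (Fin p)) (ϑ n)) ^ 2) ^ 2| ≤
        ε / (4 * (B + 1)) * (‖ϑ n‖ ^ 2) ^ 2 := by
      intro i _
      have hle := inner_sq_le_norm_sq (x i) (ϑ n)
      have hb := hball (y := (inner ℝ (x i : EuclideanSpace ℝ (Fin p)) (ϑ n)) ^ 2) (by
        rw [Real.dist_eq, sub_zero, abs_of_nonneg (sq_nonneg _)]
        exact hle.trans_lt hn)
      rw [Real.norm_eq_abs, Real.norm_of_nonneg (sq_nonneg _)] at hb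
      exact hb.trans (by gcongr)
    refine (Finset.sum_le_card_nsmul _ _ _ hi).trans ?_
    rw [Finset.card_univ, Fintype.card_fin, nsmul_eq_mul]
    calc (n : ℝ) * (ε / (4 * (B + 1)) * (‖ϑ n‖ ^ 2) ^ 2) =
          ε / (4 * (B + 1)) * (n * (‖ϑ n‖ ^ 2) ^ 2) := by ring
      _ ≤ ε / (4 * (B + 1)) * (B + 1) := by gcongr; linarith
      _ = ε / 4 := by field_simp
  have hr3 : ∀ᶠ n : ℕ in atTop, |(n : ℝ) * (Real.log (uniformMean f (ϑ n)) - ‖ϑ n‖ ^ 2 / p -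
      (a / 2 * m - 1 / (2 * (p : ℝ) ^ 2)) * (‖ϑ n‖ ^ 2) ^ 2)| ≤ ε / 4 := by
    filter_upwards [isLittleO_iff.1 (log_uniformMean_isLittleO hf hk) hε', hnk] with n hn hnk
    rw [Real.norm_eq_abs, Real.norm_of_nonneg (sq_nonneg _)] at hn
    rw [abs_mul, Nat.abs_cast]
    calc _ ≤ (n : ℝ) * (ε / (4 * (B + 1)) * (‖ϑ n‖ ^ 2) ^ 2) := by gcongr
      _ = ε / (4 * (B + 1)) * (n * (‖ϑ n‖ ^ 2) ^ 2) := by ring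
      _ ≤ ε / (4 * (B + 1)) * (B + 1) := by gcongr; linarith
      _ = ε / 4 := by field_simp
  -- Chebyshev's inequality for the fourth-order term.
  set b : ℝ := |(a - 1) / 2| + 1 with hb
  have hb0 : 0 < b := by positivity
  -- Chosen so that `b * η = ε / 4`; the `+ 1` in `b` permits the division also when `f''(0) = 1`.
  set η : ℝ := ε / (4 * b) with hη
  have hη0 : 0 < η := by positivity
  have hbound : ∀ᶠ n : ℕ in atTop, nullLaw p n {x : Fin n → UnitSphere p |
        ε ≤ |llr (altLaw n (ϑ n) f) (nullLaw p n) x -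
          (vecOuter (τ n) ⬝ᵥ (centralSeq x).ofLp -
            (1 / 2) * (vecOuter (τ n) ⬝ᵥ (infoMatrix p *ᵥ vecOuter (τ n))))|} ≤
      ENNReal.ofReal (B * (1 + m) ^ 2 * (‖ϑ n‖ ^ 2) ^ 2 / η ^ 2) := by
    filter_upwards [hr1, hr3, hnk, eventually_gt_atTop 0] with n h1 h3 hnk hn
    set Y : UnitSphere p → ℝ := fun x =>
      (inner ℝ (x : EuclideanSpace ℝ (Fin p)) (ϑ n)) ^ 4 - m * ‖ϑ n‖ ^ 4 with hY
    have hYm : Measurable Y := by fun_prop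
    have hY0 : ∫ x, Y x ∂uniformSphere p = 0 := by
      rw [hY, integral_sub (Continuous.integrable_uniformSphere (by fun_prop))
        (integrable_const _), integral_inner_pow_four]
      simp [hm]
    have hYB : ∀ x, |Y x| ≤ (1 + m) * ‖ϑ n‖ ^ 4 := by
      intro x
      have hle : (inner ℝ (x : EuclideanSpace ℝ (Fin p)) (ϑ n)) ^ 4 ≤ ‖ϑ n‖ ^ 4 := by
        have := pow_le_pow_left₀ (sq_nonneg _) (inner_sq_le_norm_sq x (ϑ n)) 2
        rwa [← pow_mul, ← pow_mul] at this
      have h0 : 0 ≤ (inner ℝ (x : EuclideanSpace ℝ (Fin p)) (ϑ n)) ^ 4 := by positivity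
      have h0' : 0 ≤ m * ‖ϑ n‖ ^ 4 := by positivity
      have h0'' : 0 ≤ ‖ϑ n‖ ^ 4 := by positivity
      rw [abs_le]
      constructor <;> simp only [hY] <;> nlinarith
    have hcheb := measure_pi_le_abs_sum_le (n := n) (U := uniformSphere p) hYm hY0 hYB hη0
    refine (measure_mono_ae ?_).trans (hcheb.trans (ENNReal.ofReal_le_ofReal ?_))
    · filter_upwards [llr_sub_quadratic_eq hf hn (hϑ n)] with x hx hmem
      change ε ≤ |_| at hmem
      change η ≤ |∑ i, Y (x i)|
      rw [hx] at hmem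
      have h1 := h1 x
      -- Inclusion of events: were the centered fourth-order sum below `η`, the total error would be
      -- at most `3 ε / 4`.
      by_contra hlt
      rw [not_le] at hlt
      have h2 : |(a - 1) / 2 * ∑ i, Y (x i)| ≤ ε / 4 := by
        rw [abs_mul]
        calc _ ≤ b * η := mul_le_mul (by linarith) hlt.le (abs_nonneg _) hb0.le
          _ = ε / 4 := by rw [hη]; field_simp
      have h4 := hmem.trans ((abs_sub _ _).trans (add_le_add_left (abs_add_le _ _) _))
      linarith
    -- One factor `n ‖ϑ n‖⁴` is absorbed by `B`; the remaining `‖ϑ n‖⁴` drives the Chebyshev bound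
    -- to zero.
    · have e : (n : ℝ) * ((1 + m) * ‖ϑ n‖ ^ 4) ^ 2 =
          (n * (‖ϑ n‖ ^ 2) ^ 2) * (1 + m) ^ 2 * (‖ϑ n‖ ^ 2) ^ 2 := by ring
      rw [e]
      gcongr
  have hlim : Tendsto (fun n => ENNReal.ofReal (B * (1 + m) ^ 2 * (‖ϑ n‖ ^ 2) ^ 2 / η ^ 2)) atTop
      (𝓝 0) := by
    have := ENNReal.tendsto_ofReal ((hk4.const_mul (B * (1 + m) ^ 2)).div_const (η ^ 2))
    simpa using this
  exact tendsto_of_tendsto_of_tendsto_of_le_of_le' tendsto_const_nhds hlim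
    (Eventually.of_forall fun _ => zero_le) hbound
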